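/- Let $n\ge 1$ and $s\in(0,1)$. For $t\in\mathbb R$ put $$g_s(t)=(1+t^2)^{-\frac{n+1+s}{2}},\qquad G_s(t)=\int_0^t g_s(\tau)\,d\tau,\qquad \mathcal G_s(t)=\int_0^t G_s(\tau)\,d\tau .$$ For an open set $\Omega\subset\mathbb R^n$ write $\mathcal C\Omega=\mathbb R^n\setminus\Omega$, $Q(\Omega)=\mathbb R^{2n}\setminus(\mathcal C\Omega)^2$, and, for $\delta\in\mathbb R$, $\Omega_\delta=\{x\in\mathbb R^n: d(x,\Omega)-d(x,\mathcal C\Omega)<\delta\}$. For measurable $u$ put $$\|u\|_{W^{s,1}(\Omega)}=\int_\Omega|u|\,dx+\int_\Omega\int_\Omega\frac{|u(x)-u(y)|}{|x-y|^{n+s}}\,dx\,dy,\qquad \mathrm{Tail}_s(u,O;x)=\int_O\frac{|u(y)|}{|x-y|^{n+s}}\,dy .$$ Given an open set $A\subset\Omega$, an obstacle $\psi\in L^\infty(A)$ and a function $\varphi:\mathbb R^n\to\mathbb R$, let $\mathcal W^s_{\varphi,\psi}(\Omega,A)$ be the set of all $u:\mathbb R^n\to\mathbb R$ such that $u|_\Omega\in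 W^{s,1}(\Omega)$, $u=\varphi$ on $\mathcal C\Omega$, and $u\ge\psi$ a.e. in $A$. A function $u\in\mathcal W^s_{\varphi,\psi}(\Omega,A)$ *solves the obstacle problem* if, for every $v\in\mathcal W^s_{\varphi,\psi}(\Omega,A)$, the following integral converges absolutely and satisfies $$\iint_{Q(\Omega)}\left\{\mathcal G_s\Big(\frac{u(x)-u(y)}{|x-y|}\Big)-\mathcal G_s\Big(\frac{v(x)-v(y)}{|x-y|}\Big)\right\}\frac{dx\,dy}{|x-y|^{n-1+s}}\le 0 .$$ **Theorem.** Let $n\ge1$ and $s\in(0,1)$. There exists a constant $\Upsilon=\Upsilon(n,s)>1$ such that for every bounded open set $\Omega\subset\mathbb R^n$ with Lipschitz boundary there is a constant $C=C(n,s,\Omega)>0$ with the following property. Let $A\subset\Omega$ be open, let $\psi\in L^\infty(A)$, and let $\varphi:\mathbb R^n\to\mathbb R$ be measurable on $\mathcal C\Omega$ with $$\mathrm{Tail}_s\big(\varphi,\Omega_{\Upsilon\operatorname{diam}(\Omega)}\setminus\Omega;\,\cdot\,\big)\in L^1(\Omega).$$ Then there exists a function $u\in\mathcal W^s_{\varphi,\psi}(\Omega,A)$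 that solves the obstacle problem, it is unique up to equality almost everywhere, and $$\|u\|_{W^{s,1}(\Omega)}\le C\Big(\big\|\mathrm{Tail}_s(\varphi,\Omega_{\Upsilon\operatorname{diam}(\Omega)}\setminus\Omega;\,\cdot\,)\big\|_{L^1(\Omega)}+\|\psi\|_{L^\infty(A)}+1\Big).$$ -/

import Mathlib

open MeasureTheory Set
open scoped ENNReal RealInnerProductSpace

noncomputable section

namespace NonlocalObstacle

/-- Euclidean space `ℝⁿ` with its Euclidean norm. -/
abbrev E (n : ℕ) := EuclideanSpace ℝ (Fin n)

/-- `g_s(t) = (1 + t²)^{-(n+1+s)/2}`. -/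
def g (n : ℕ) (s t : ℝ) : ℝ := 1 / (1 + t ^ 2) ^ (((n : ℝ) + 1 + s) / 2)

/-- `G_s(t) = ∫₀ᵗ g_s(τ) dτ`. -/
def G (n : ℕ) (s t : ℝ) : ℝ := ∫ τ in (0 : ℝ)..t, g n s τ

/-- `𝒢_s(t) = ∫₀ᵗ G_s(τ) dτ`. -/
def GG (n : ℕ) (s t : ℝ) : ℝ := ∫ τ in (0 : ℝ)..t, G n s τ

/-- An open set has Lipschitz boundary: near each boundary point `x₀` there are a unit vector `e`
and a Lipschitz function `γ` on the hyperplane `e^⊥` such that `Ω` is locally the strict epigraph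
of `γ` in the direction `e`. -/
def HasLipschitzBoundary {n : ℕ} (Ω : Set (E n)) : Prop :=
  ∀ x₀ ∈ frontier Ω, ∃ e : E n, ‖e‖ = 1 ∧
    ∃ γ : ((Submodule.span ℝ {e})ᗮ : Submodule ℝ (E n)) → ℝ, (∃ K, LipschitzWith K γ) ∧
      ∃ r > 0, ∀ x ∈ Metric.ball x₀ r,
        (x ∈ Ω ↔ γ ((Submodule.span ℝ {e})ᗮ.orthogonalProjectionOnto x) < ⟪e, x⟫)

/-- The signed distance `d(x, Ω) - d(x, Ωᶜ)`, negative inside `Ω`. -/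
def signedDist {n : ℕ} (Ω : Set (E n)) (x : E n) : ℝ :=
  Metric.infDist x Ω - Metric.infDist x Ωᶜ

/-- `Ω_δ`, the set of points whose signed distance from the boundary of `Ω` is less than `δ`. -/
def nbhd {n : ℕ} (Ω : Set (E n)) (δ : ℝ) : Set (E n) := {x | signedDist Ω x < δ}

/-- `Tail_s(u, O; x) = ∫_O |u(y)| / |x - y|^{n+s} dy`, with values in `[0, ∞]`. -/
def tail {n : ℕ} (s : ℝ) (u : E n → ℝ) (O : Set (E n)) (x : E n) : ℝ≥0∞ :=
  ∫⁻ y in O, ENNReal.ofReal (|u y| / ‖x - y‖ ^ ((n : ℝ) + s))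

/-- The Gagliardo seminorm of `W^{s,1}(Ω)`, with values in `[0, ∞]`. -/
def gagliardo {n : ℕ} (s : ℝ) (Ω : Set (E n)) (u : E n → ℝ) : ℝ≥0∞ :=
  ∫⁻ x in Ω, ∫⁻ y in Ω, ENNReal.ofReal (|u x - u y| / ‖x - y‖ ^ ((n : ℝ) + s))

/-- The norm of `W^{s,1}(Ω)`: the `L¹(Ω)` norm plus the Gagliardo seminorm. -/
def wNorm {n : ℕ} (s : ℝ) (Ω : Set (E n)) (u : E n → ℝ) : ℝ≥0∞ :=
  eLpNorm u 1 (volume.restrict Ω) + gagliardo s Ω u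

/-- `𝒲^s(Ω)`: functions on `ℝⁿ` whose restriction to `Ω` lies in `W^{s,1}(Ω)`. -/
def W {n : ℕ} (s : ℝ) (Ω : Set (E n)) : Set (E n → ℝ) :=
  {u | MemLp u 1 (volume.restrict Ω) ∧ gagliardo s Ω u < ∞}

/-- `𝒲^s_{φ,ψ}(Ω, A)`: the admissible class, with exterior datum `φ` and obstacle `ψ` in `A`. -/
def admissible {n : ℕ} (s : ℝ) (Ω A : Set (E n)) (φ ψ : E n → ℝ) : Set (E n → ℝ) :=
  {u | u ∈ W s Ω ∧ (∀ x ∈ Ωᶜ, u x = φ x) ∧ ∀ᵐ x ∂(volume.restrict A), ψ x ≤ u x}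

/-- `Q(Ω) = ℝ²ⁿ ∖ (Ωᶜ × Ωᶜ)`. -/
def Q {n : ℕ} (Ω : Set (E n)) : Set (E n × E n) := (Ωᶜ ×ˢ Ωᶜ)ᶜ

/-- The difference of the energy densities of `u` and `v` at `(x, y)`. -/
def densityDiff {n : ℕ} (s : ℝ) (u v : E n → ℝ) (p : E n × E n) : ℝ :=
  (GG n s ((u p.1 - u p.2) / ‖p.1 - p.2‖) - GG n s ((v p.1 - v p.2) / ‖p.1 - p.2‖)) /
    ‖p.1 - p.2‖ ^ ((n : ℝ) - 1 + s)

/-- `u` solves the obstacle problem: it is admissible and, against every admissible competitor, the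
integral over `Q(Ω)` of the difference of the energy densities converges and is nonpositive. -/
def SolvesObstacle {n : ℕ} (s : ℝ) (Ω A : Set (E n)) (φ ψ : E n → ℝ) (u : E n → ℝ) : Prop :=
  u ∈ admissible s Ω A φ ψ ∧ ∀ v ∈ admissible s Ω A φ ψ,
    IntegrableOn (densityDiff s u v) (Q Ω) volume ∧ ∫ p in Q Ω, densityDiff s u v p ≤ 0

end NonlocalObstacle

end

open NonlocalObstacle

/-!
The datum `φ` is arbitrary far from `Ω`, so the energy itself may be infinite and only differences
of energies make sense. Split `Q(Ω)` into `Ω × Ω` and the two mixed parts. For `x ∈ Ω`, the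
interaction with the exterior datum is a function `extEnergy` of the value `u x` alone, an integral
over `Ωᶜ` that converges for every `φ` after the contribution of a constant `K` is subtracted,
since `GG` is Lipschitz.

*Coercivity.* `GG` grows linearly, so exterior points within `Υ diam Ω` of `Ω` contribute at least
a multiple of `|u x|`, up to the tail of `φ`; the farther ones may contribute negatively, but for
`Υ` large depending on `n` and `s` only, their total mass is much smaller
(`near_mass_sub_far_mass_ge`). Hence `extEnergy` is at least `c |u x| - b x` with `b` integrable
(`extEnergy_add_lowerBd_ge`), and after `b` is added, the renormalized `energy` is a sum of
integrals of nonnegative functions, to which Fatou's lemma applies (`energy_le_liminf`).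

*Existence.* Convexity of `GG` makes the energy submodular: `E (u ⊓ v) + E (u ⊔ v) ≤ E u + E v`.
Therefore infima of tails of a fast minimizing sequence are again almost minimizing, and they
converge monotonically. This gives a minimizer without any compactness theorem
(`exists_minimizer_of_submodular`).

*Role of the boundary.* The integrals over the mixed parts converge, and the energy of every
competitor is finite, because `∫_Ω |u(x)| ∫_{Ωᶜ} |x - y|^{-n-s} dy dx` is finite for
`u ∈ W^{s,1}(Ω)`. This is the fractional Hardy inequality for `s < 1`
(`lintegral_mul_extMass_lt_top`). Near a boundary point it is proved by comparing `u(x)` with the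
values at points of about twice the height over the boundary graph: this costs a factor `2^s` in the
weight `height^{-s}` and gains a factor `2` in volume.

*Uniqueness* follows from strict convexity (`SolvesObstacle.ae_eq`), and the estimate from
coercivity and comparison with the function that is constantly `‖ψ‖_∞` in `Ω`.
-/

noncomputable section

namespace NonlocalObstacle

/-! ### The one-dimensional functions `g`, `G` and `GG` -/

lemma continuous_g (n : ℕ) (s : ℝ) : Continuous (g n s) := by
  unfold g
  refine continuous_const.div ?_ fun t => (Real.rpow_pos_of_pos (by positivity) _).ne'
  exact (continuous_const.add (continuous_id.pow 2)).rpow_const fun t => Or.inl (by simp; positivity)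

lemma g_pos (n : ℕ) (s t : ℝ) : 0 < g n s t := by
  unfold g; positivity

lemma g_neg (n : ℕ) (s t : ℝ) : g n s (-t) = g n s t := by
  simp [g]

lemma g_le {n : ℕ} {s : ℝ} (hn : 1 ≤ n) (hs : 0 < s) (t : ℝ) : g n s t ≤ (1 + t ^ 2)⁻¹ := by
  unfold g
  rw [one_div]
  refine inv_anti₀ (by positivity) ?_
  have hn' : (1 : ℝ) ≤ n := by exact_mod_cast hn
  calc 1 + t ^ 2 = (1 + t ^ 2) ^ (1 : ℝ) := (Real.rpow_one _).symm
    _ ≤ _ := Real.rpow_le_rpow_of_exponent_le (by nlinarith [sq_nonneg t]) (by linarith)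

lemma hasDerivAt_G (n : ℕ) (s t : ℝ) : HasDerivAt (G n s) (g n s t) t :=
  intervalIntegral.integral_hasDerivAt_right ((continuous_g n s).intervalIntegrable _ _)
    (continuous_g n s).aestronglyMeasurable.stronglyMeasurableAtFilter
    (continuous_g n s).continuousAt

lemma continuous_G (n : ℕ) (s : ℝ) : Continuous (G n s) :=
  continuous_iff_continuousAt.2 fun t => (hasDerivAt_G n s t).continuousAt

lemma strictMono_G (n : ℕ) (s : ℝ) : StrictMono (G n s) :=
  strictMono_of_hasDerivAt_pos (hasDerivAt_G n s) (g_pos n s)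

lemma G_zero (n : ℕ) (s : ℝ) : G n s 0 = 0 := by simp [G]

lemma G_neg (n : ℕ) (s t : ℝ) : G n s (-t) = -G n s t := by
  have := intervalIntegral.integral_comp_neg (a := 0) (b := t) (g n s)
  simp only [g_neg, neg_zero] at this
  rw [G, G, this, intervalIntegral.integral_symm]

lemma G_one_pos (n : ℕ) (s : ℝ) : 0 < G n s 1 := by
  simpa [G_zero] using strictMono_G n s zero_lt_one

lemma G_le_two {n : ℕ} {s : ℝ} (hn : 1 ≤ n) (hs : 0 < s) (t : ℝ) : G n s t ≤ 2 := by
  rcases le_total t 0 with ht | ht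
  · have := (strictMono_G n s).monotone ht
    rw [G_zero] at this; linarith
  · have h1 : G n s t ≤ ∫ τ in (0 : ℝ)..t, (1 + τ ^ 2)⁻¹ := by
      refine intervalIntegral.integral_mono_on ht ((continuous_g n s).intervalIntegrable _ _) ?_
        fun x _ => g_le hn hs x
      exact (Continuous.inv₀ (by fun_prop) fun x => by positivity).intervalIntegrable _ _
    rw [integral_inv_one_add_sq, Real.arctan_zero, sub_zero] at h1
    have := Real.arctan_lt_pi_div_two t
    have := Real.pi_lt_d2
    linarith

lemma abs_G_le_two {n : ℕ} {s : ℝ} (hn : 1 ≤ n) (hs : 0 < s) (t : ℝ) : |G n s t| ≤ 2 := by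
  rw [abs_le]
  have := G_le_two hn hs t
  have := G_le_two hn hs (-t)
  rw [G_neg] at this
  constructor <;> linarith

lemma hasDerivAt_GG (n : ℕ) (s t : ℝ) : HasDerivAt (GG n s) (G n s t) t :=
  intervalIntegral.integral_hasDerivAt_right ((continuous_G n s).intervalIntegrable _ _)
    (continuous_G n s).aestronglyMeasurable.stronglyMeasurableAtFilter
    (continuous_G n s).continuousAt

lemma continuous_GG (n : ℕ) (s : ℝ) : Continuous (GG n s) :=
  continuous_iff_continuousAt.2 fun t => (hasDerivAt_GG n s t).continuousAt

lemma GG_zero (n : ℕ) (s : ℝ) : GG n s 0 = 0 := by simp [GG]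

lemma GG_neg (n : ℕ) (s t : ℝ) : GG n s (-t) = GG n s t := by
  have := intervalIntegral.integral_comp_neg (a := 0) (b := t) (G n s)
  simp only [G_neg, neg_zero, intervalIntegral.integral_neg] at this
  rw [GG, GG, intervalIntegral.integral_symm, ← this, neg_neg]

lemma strictConvexOn_GG (n : ℕ) (s : ℝ) : StrictConvexOn ℝ univ (GG n s) := by
  refine StrictMono.strictConvexOn_univ_of_deriv (continuous_GG n s) ?_
  rw [show deriv (GG n s) = G n s from funext fun t => (hasDerivAt_GG n s t).deriv]
  exact strictMono_G n s

lemma abs_GG_sub_le {n : ℕ} {s : ℝ} (hn : 1 ≤ n) (hs : 0 < s) (a b : ℝ) :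
    |GG n s a - GG n s b| ≤ 2 * |a - b| := by
  have := Convex.norm_image_sub_le_of_norm_hasDerivWithin_le (f := GG n s) (f' := G n s) (C := 2)
    (s := univ) (fun x _ => (hasDerivAt_GG n s x).hasDerivWithinAt)
    (fun x _ => abs_G_le_two hn hs x) convex_univ (mem_univ b) (mem_univ a)
  simpa using this

lemma GG_ge (n : ℕ) (s t : ℝ) : G n s 1 * (|t| - 1) ≤ GG n s t := by
  have key : ∀ t : ℝ, 0 ≤ t → G n s 1 * (t - 1) ≤ GG n s t := by
    intro t ht
    have h0 : ∀ a b : ℝ, a ≤ b → G n s a * (b - a) ≤ GG n s b - GG n s a := by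
      intro a b hab
      have h1 : ∫ τ in a..b, G n s a ≤ ∫ τ in a..b, G n s τ :=
        intervalIntegral.integral_mono_on hab (by simp) ((continuous_G n s).intervalIntegrable _ _)
          fun x hx => (strictMono_G n s).monotone hx.1
      rw [intervalIntegral.integral_eq_sub_of_hasDerivAt (fun x _ => hasDerivAt_GG n s x)
        ((continuous_G n s).intervalIntegrable _ _)] at h1
      simpa [mul_comm] using h1
    have hnn := h0 0 t ht
    rw [G_zero, GG_zero] at hnn
    rcases le_total 1 t with h1 | h1
    · have h2 := h0 1 t h1
      have h3 := h0 0 1 zero_le_one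
      rw [G_zero, GG_zero] at h3
      linarith
    · nlinarith [G_one_pos n s]
  rcases le_total 0 t with ht | ht
  · rw [abs_of_nonneg ht]; exact key t ht
  · rw [abs_of_nonpos ht, ← GG_neg]; exact key (-t) (by linarith)

lemma GG_nonneg (n : ℕ) (s t : ℝ) : 0 ≤ GG n s t := by
  have h := (strictConvexOn_GG n s).convexOn.2 (mem_univ t) (mem_univ (-t))
    (by norm_num : (0 : ℝ) ≤ 1 / 2) (by norm_num : (0 : ℝ) ≤ 1 / 2) (by norm_num)
  simp only [smul_eq_mul, GG_neg] at h
  rw [show (1 : ℝ) / 2 * t + 1 / 2 * -t = 0 by ring, GG_zero] at h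
  linarith

/-- Truncation does not increase a convex interaction: `(a, b)` and `(c, d)` are the values of two
functions at a pair of points. -/
lemma map_min_sub_min_add_map_max_sub_max_le {f : ℝ → ℝ} (hf : ConvexOn ℝ univ f)
    (a b c d : ℝ) :
    f (min a c - min b d) + f (max a c - max b d) ≤ f (a - b) + f (c - d) := by
  have key : ∀ p q r : ℝ, p ≤ q → p ≤ r → f q + f r ≤ f p + f (q + r - p) := by
    intro p q r hq hr
    rcases eq_or_lt_of_le (show p ≤ q + r - p by linarith) with h | h
    · have h1 : q = p := by linarith
      have h2 : r = p := by linarith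
      subst h1; subst h2; simp
    · have hpos : 0 < q + r - p - p := by linarith
      have h1 := hf.2 (mem_univ p) (mem_univ (q + r - p))
        (div_nonneg (sub_nonneg.2 hr) hpos.le) (div_nonneg (sub_nonneg.2 hq) hpos.le)
        (by rw [← add_div, div_eq_one_iff_eq hpos.ne']; ring)
      have h2 := hf.2 (mem_univ p) (mem_univ (q + r - p))
        (div_nonneg (sub_nonneg.2 hq) hpos.le) (div_nonneg (sub_nonneg.2 hr) hpos.le)
        (by rw [← add_div, div_eq_one_iff_eq hpos.ne']; ring)
      simp only [smul_eq_mul] at h1 h2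
      rw [show (r - p) / (q + r - p - p) * p + (q - p) / (q + r - p - p) * (q + r - p) = q by
        field_simp; ring] at h1
      rw [show (q - p) / (q + r - p - p) * p + (r - p) / (q + r - p - p) * (q + r - p) = r by
        field_simp; ring] at h2
      have h3 : (r - p) / (q + r - p - p) + (q - p) / (q + r - p - p) = 1 := by
        rw [← add_div, div_eq_one_iff_eq hpos.ne']; ring
      have : f q + f r ≤ ((r - p) / (q + r - p - p) + (q - p) / (q + r - p - p)) * f p +
        ((r - p) / (q + r - p - p) + (q - p) / (q + r - p - p)) * f (q + r - p) := by linarith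
      rw [h3] at this; linarith
  rcases le_total a c with h1 | h1 <;> rcases le_total b d with h2 | h2 <;>
    simp only [min_eq_left, min_eq_right, max_eq_left, max_eq_right, h1, h2]
  · exact le_rfl
  · have := key (a - b) (a - d) (c - b) (by linarith) (by linarith)
    rwa [show a - d + (c - b) - (a - b) = c - d by ring] at this
  · have := key (c - d) (c - b) (a - d) (by linarith) (by linarith)
    rw [show c - b + (a - d) - (c - d) = a - b by ring] at this
    linarith
  · linarith

/-! ### Integrals of the kernels -/

/-- The integral of `‖z‖^{-n-s}` over the complement of the unit ball of `ℝⁿ`. -/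
def kernelMass (n : ℕ) (s : ℝ) : ℝ := n * (volume : Measure (E n)).real (Metric.ball 0 1) / s

lemma kernelMass_pos {n : ℕ} {s : ℝ} (hn : 1 ≤ n) (hs : 0 < s) : 0 < kernelMass n s := by
  have hn' : (0 : ℝ) < n := by exact_mod_cast hn
  have : 0 < (volume : Measure (E n)).real (Metric.ball 0 1) :=
    ENNReal.toReal_pos (Metric.measure_ball_pos _ _ one_pos).ne' measure_ball_lt_top.ne
  unfold kernelMass
  positivity

lemma finrank_E (n : ℕ) : Module.finrank ℝ (E n) = n := by simp

lemma nontrivial_E {n : ℕ} (hn : 1 ≤ n) : Nontrivial (E n) :=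
  Module.nontrivial_of_finrank_pos (R := ℝ) (by rw [finrank_E]; omega)

/-- By scaling, the tail of the kernel `‖x - y‖^{-n-s}` outside a ball of radius `R` is
proportional to `R^{-s}`. -/
lemma lintegral_kernel_tail {n : ℕ} {s : ℝ} (hn : 1 ≤ n) (hs : 0 < s) (x : E n) {R : ℝ}
    (hR : 0 < R) :
    ∫⁻ y in {y | R ≤ ‖x - y‖}, ENNReal.ofReal (1 / ‖x - y‖ ^ ((n : ℝ) + s)) =
      ENNReal.ofReal (kernelMass n s * R ^ (-s)) := by
  have := nontrivial_E hn
  let f : ℝ → ℝ := (Ici R).indicator fun r => 1 / r ^ ((n : ℝ) + s)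
  have hrad : ∀ r ∈ Ioi (0 : ℝ), r ^ (n - 1) • f r =
      (Ici R).indicator (fun r => r ^ (-s - 1)) r := by
    intro r hr
    by_cases h : r ∈ Ici R
    · simp only [f, indicator_of_mem h, smul_eq_mul]
      rw [← Real.rpow_natCast, mul_one_div, ← Real.rpow_sub hr]
      congr 1
      rw [Nat.cast_sub hn]; push_cast; ring
    · simp only [f, indicator_of_notMem h, smul_zero]
  have hsub : Ici R ⊆ Ioi 0 := fun r hr => hR.trans_le hr
  have hint1 : IntegrableOn (fun r : ℝ => r ^ (-s - 1)) (Ici R) :=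
    (integrableOn_Ici_iff_integrableOn_Ioi).2 (integrableOn_Ioi_rpow_of_lt (by linarith) hR)
  have hint : Integrable (fun z : E n => f ‖z‖) := by
    rw [integrable_fun_norm_addHaar volume, finrank_E, integrableOn_congr_fun hrad measurableSet_Ioi]
    exact ((integrable_indicator_iff measurableSet_Ici).2 hint1).integrableOn
  have hval : ∫ z : E n, f ‖z‖ = kernelMass n s * R ^ (-s) := by
    rw [integral_fun_norm_addHaar volume, finrank_E, setIntegral_congr_fun measurableSet_Ioi hrad,
      setIntegral_indicator measurableSet_Ici, inter_eq_right.2 hsub, integral_Ici_eq_integral_Ioi,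
      integral_Ioi_rpow_of_lt (by linarith) hR, kernelMass]
    simp only [nsmul_eq_mul, smul_eq_mul, sub_add_cancel]
    ring
  have hnn : ∀ z : E n, 0 ≤ f ‖z‖ := fun z => indicator_nonneg (fun r hr => by
    have : 0 < r := hsub hr
    positivity) _
  rw [← hval, ofReal_integral_eq_lintegral_ofReal hint (Filter.Eventually.of_forall hnn),
    ← lintegral_sub_left_eq_self (fun z : E n => ENNReal.ofReal (f ‖z‖)) x, ← lintegral_indicator]
  · refine lintegral_congr fun y => ?_
    by_cases h : R ≤ ‖x - y‖
    · simp [f, indicator, h]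
    · simp [f, indicator, h]
  · exact measurableSet_le measurable_const (by fun_prop)

/-- The kernel `‖x - y‖^{-(n-1+s)}` is locally integrable, uniformly in `x`, because `s < 1`. -/
lemma exists_lintegral_kernel_ball_le {n : ℕ} {s : ℝ} (hn : 1 ≤ n) (hs1 : s < 1) (R : ℝ) :
    ∃ C : ℝ, 0 ≤ C ∧ ∀ x : E n, ∫⁻ y in Metric.ball x R,
      ENNReal.ofReal (1 / ‖x - y‖ ^ ((n : ℝ) - 1 + s)) ≤ ENNReal.ofReal C := by
  have hint : IntegrableOn (fun z : E n => 1 / ‖z‖ ^ ((n : ℝ) - 1 + s)) (Metric.ball 0 R) := by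
    refine integrableOn_ball_of_norm_le_rpow (C := 1) (α := (n : ℝ) - 1 + s)
      (by rwa [finrank_E]) (by rw [finrank_E]; linarith) (Filter.Eventually.of_forall fun z => ?_) ?_
    · rw [Real.rpow_neg (norm_nonneg _), one_mul, one_div, Real.norm_of_nonneg (by positivity)]
    · exact (by fun_prop : Measurable fun z : E n => 1 / ‖z‖ ^ ((n : ℝ) - 1 + s)).aestronglyMeasurable
  refine ⟨∫ z in Metric.ball (0 : E n) R, 1 / ‖z‖ ^ ((n : ℝ) - 1 + s),
    integral_nonneg fun z => by positivity, fun x => ?_⟩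
  rw [ofReal_integral_eq_lintegral_ofReal hint (Filter.Eventually.of_forall fun z => by positivity),
    ← lintegral_indicator measurableSet_ball, ← lintegral_indicator measurableSet_ball,
    ← lintegral_sub_left_eq_self ((Metric.ball (0 : E n) R).indicator _) x]
  refine lintegral_mono fun y => le_of_eq ?_
  by_cases h : ‖x - y‖ < R
  · rw [indicator_of_mem (by simpa [dist_eq_norm, norm_sub_rev] using h),
      indicator_of_mem (by simpa using h)]
  · rw [indicator_of_notMem (by simpa [dist_eq_norm, norm_sub_rev] using h),
      indicator_of_notMem (by simpa using h)]

/-! ### The fractional Hardy inequality on Lipschitz domains -/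

/-- A shear along `ζ` whose profile `d` increases at rate at least `c` in the direction `ζ`
expands volumes by a factor at least `1 + c`. By Rademacher's theorem, the area formula applies,
and the Jacobian of the shear is `1 + ∂_ζ d`. -/
lemma lintegral_comp_add_smul_le {V : Type*} [NormedAddCommGroup V] [NormedSpace ℝ V]
    [FiniteDimensional ℝ V] [MeasurableSpace V] [BorelSpace V] (μ : Measure V) [μ.IsAddHaarMeasure]
    {d : V → ℝ} {K : NNReal} (hd : LipschitzWith K d) (ζ : V) {c : ℝ} (hc : 0 < c)
    (hmono : ∀ x t, 0 ≤ t → c * t ≤ d (x + t • ζ) - d x) (F : V → ℝ≥0∞) :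
    ENNReal.ofReal (1 + c) * ∫⁻ x, F (x + d x • ζ) ∂μ ≤ ∫⁻ x, F x ∂μ := by
  let S : Set V := {x | DifferentiableAt ℝ d x}
  have hS : MeasurableSet S := measurableSet_of_differentiableAt ℝ d
  have hSae : S =ᵐ[μ] univ := by
    rw [Filter.eventuallyEq_univ]
    exact hd.ae_differentiableAt
  let T : V → V := fun x => x + d x • ζ
  let T' : V → V →L[ℝ] V := fun x => ContinuousLinearMap.id ℝ V + (fderiv ℝ d x).smulRight ζ
  have hT : ∀ x ∈ S, HasFDerivWithinAt T (T' x) S x := fun x hx =>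
    ((hasFDerivAt_id x).add
      ((DifferentiableAt.hasFDerivAt hx).smul_const ζ)).hasFDerivWithinAt
  have hinj : InjOn T S := by
    have key : ∀ x y, T x = T y → d x ≤ d y := by
      intro x y h
      by_contra! hlt
      have hy : y = x + (d x - d y) • ζ := by
        have : x + d x • ζ = y + d y • ζ := h
        rw [sub_smul, ← add_sub_assoc, this, add_sub_cancel_right]
      have h1 := hmono x (d x - d y) (by linarith)
      rw [← hy] at h1
      nlinarith
    intro x _ y _ h
    have h1 : d x = d y := le_antisymm (key x y h) (key y x h.symm)
    have h2 : x + d x • ζ = y + d y • ζ := h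
    rw [h1] at h2
    exact add_right_cancel h2
  have hdet : ∀ x ∈ S, ENNReal.ofReal (1 + c) ≤ ENNReal.ofReal |(T' x).det| := by
    intro x hx
    refine ENNReal.ofReal_le_ofReal ?_
    have h1 : (T' x).det = 1 + fderiv ℝ d x ζ := by
      have : ((T' x : V →L[ℝ] V) : V →ₗ[ℝ] V) =
          LinearMap.transvection (fderiv ℝ d x : V →ₗ[ℝ] ℝ) ζ := by
        ext v; simp [T', LinearMap.transvection]
      rw [ContinuousLinearMap.det, this, LinearMap.transvection.det]
      rfl
    have h2 : c ≤ fderiv ℝ d x ζ := by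
      have h3 : HasDerivAt (fun t : ℝ => d (x + t • ζ)) (fderiv ℝ d x ζ) 0 := by
        have h5 : HasDerivAt (fun t : ℝ => x + t • ζ) ζ 0 := by
          simpa using ((hasDerivAt_id (0 : ℝ)).smul_const ζ).const_add x
        refine HasFDerivAt.comp_hasDerivAt (f := fun t : ℝ => x + t • ζ) (l := d) 0 ?_ h5
        rw [zero_smul, add_zero]
        exact DifferentiableAt.hasFDerivAt hx
      have h4 := (hasDerivAt_iff_tendsto_slope.1 h3).mono_left
        (nhdsWithin_mono (0 : ℝ) (show Ioi (0 : ℝ) ⊆ {0}ᶜ from fun t ht => ne_of_gt ht))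
      refine ge_of_tendsto h4 ?_
      filter_upwards [self_mem_nhdsWithin] with t ht
      have ht' : 0 < t := ht
      rw [slope_def_field, sub_zero, le_div_iff₀ ht']
      simpa using hmono x t ht'.le
    rw [h1]
    exact (by linarith : 1 + c ≤ 1 + fderiv ℝ d x ζ).trans (le_abs_self _)
  calc ENNReal.ofReal (1 + c) * ∫⁻ x, F (T x) ∂μ
      = ENNReal.ofReal (1 + c) * ∫⁻ x in S, F (T x) ∂μ := by
        rw [Measure.restrict_congr_set hSae, Measure.restrict_univ]
    _ ≤ ∫⁻ x in S, ENNReal.ofReal (1 + c) * F (T x) ∂μ := lintegral_const_mul_le _ _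
    _ ≤ ∫⁻ x in S, ENNReal.ofReal |(T' x).det| * F (T x) ∂μ :=
        setLIntegral_mono' hS fun x hx => mul_le_mul' (hdet x hx) le_rfl
    _ = ∫⁻ x in T '' S, F x ∂μ := (lintegral_image_eq_lintegral_abs_det_fderiv_mul μ hS hT hinj F).symm
    _ ≤ ∫⁻ x, F x ∂μ := setLIntegral_le_lintegral _ _

lemma lintegral_comp_smul {V : Type*} [NormedAddCommGroup V] [NormedSpace ℝ V]
    [FiniteDimensional ℝ V] [MeasurableSpace V] [BorelSpace V] (μ : Measure V) [μ.IsAddHaarMeasure]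
    {f : V → ℝ≥0∞} (hf : Measurable f) {r : ℝ} (hr : r ≠ 0) :
    ∫⁻ z, f (r • z) ∂μ = ENNReal.ofReal |(r ^ Module.finrank ℝ V)⁻¹| * ∫⁻ z, f z ∂μ := by
  rw [← lintegral_map (g := fun z => r • z) hf (measurable_const_smul r),
    Measure.map_addHaar_smul μ hr, lintegral_smul_measure, smul_eq_mul]

/-- A Lipschitz graph chart of `Ω` near `x₀`: inside the ball of radius `r` about `x₀`, the set `Ω`
is where the height `d` over the graph is positive; `d` is Lipschitz and grows at unit rate in the
direction of the unit vector `e`. -/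
structure GraphChart {n : ℕ} (Ω : Set (E n)) (x₀ e : E n) (d : E n → ℝ) (K : NNReal) (r : ℝ) :
    Prop where
  norm_dir : ‖e‖ = 1
  lip : LipschitzWith K d
  lip_pos : 0 < K
  height_add : ∀ x t, d (x + t • e) = d x + t
  radius_pos : 0 < r
  mem_iff : ∀ x ∈ Metric.ball x₀ r, x ∈ Ω ↔ 0 < d x

lemma HasLipschitzBoundary.exists_graphChart {n : ℕ} {Ω : Set (E n)}
    (hΩ : HasLipschitzBoundary Ω) {x₀ : E n} (hx₀ : x₀ ∈ frontier Ω) :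
    ∃ e d K r, GraphChart Ω x₀ e d K r := by
  obtain ⟨e, he, γ, ⟨L, hL⟩, r, hr, h⟩ := hΩ x₀ hx₀
  let P := (Submodule.span ℝ {e})ᗮ.orthogonalProjectionOnto
  have hlip : LipschitzWith (1 + L * ‖P‖₊) (fun x => ⟪e, x⟫ - γ (P x)) := by
    refine LipschitzWith.sub ?_ (hL.comp P.lipschitz)
    refine LipschitzWith.of_dist_le_mul fun x y => ?_
    rw [Real.dist_eq, ← inner_sub_right, dist_eq_norm]
    simpa [he] using abs_real_inner_le_norm e (x - y)
  refine ⟨e, fun x => ⟪e, x⟫ - γ (P x), 1 + L * ‖P‖₊, r, he, hlip, by positivity, ?_, hr, ?_⟩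
  · intro x t
    have : P e = 0 := by
      refine (Submodule.orthogonalProjectionOnto_eq_zero_iff).2 ?_
      exact Submodule.le_orthogonal_orthogonal _ (Submodule.mem_span_singleton_self e)
    simp only [map_add, map_smul, this, smul_zero, add_zero, inner_add_right, inner_smul_right,
      real_inner_self_eq_norm_sq, he]
    ring
  · intro x hx
    rw [h x hx, sub_pos]

namespace GraphChart

variable {n : ℕ} {Ω : Set (E n)} {x₀ e : E n} {d : E n → ℝ} {K : NNReal} {r : ℝ}

lemma abs_height_sub_le (h : GraphChart Ω x₀ e d K r) (x y : E n) : |d x - d y| ≤ K * ‖x - y‖ := by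
  have := h.lip.dist_le_mul x y
  rwa [Real.dist_eq, dist_eq_norm] at this

lemma abs_height_add_smul_sub_le (h : GraphChart Ω x₀ e d K r) (x z : E n) {t : ℝ} (ht : 0 ≤ t) :
    |d (x + t • (e + z)) - (d x + t)| ≤ K * ‖z‖ * t := by
  have := h.abs_height_sub_le (x + t • (e + z)) (x + t • e)
  rw [h.height_add, show x + t • (e + z) - (x + t • e) = t • z by rw [smul_add]; abel, norm_smul,
    Real.norm_of_nonneg ht] at this
  linarith

lemma height_le (h : GraphChart Ω x₀ e d K r) (hx₀ : x₀ ∉ Ω) (x : E n) :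
    d x ≤ K * ‖x - x₀‖ := by
  have h0 : d x₀ ≤ 0 := by
    by_contra! hlt
    exact hx₀ ((h.mem_iff x₀ (Metric.mem_ball_self h.radius_pos)).2 hlt)
  have := (abs_le.1 (h.abs_height_sub_le x x₀)).2
  linarith

end GraphChart

lemma exists_rpow_two_add_lt {s : ℝ} (hs1 : s < 1) :
    ∃ κ : ℝ, 0 < κ ∧ κ < 1 ∧ (2 + κ) ^ s < 2 - κ := by
  have h0 : (2 + (0 : ℝ)) ^ s < 2 - 0 := by
    simpa using Real.rpow_lt_rpow_of_exponent_lt (by norm_num : (1 : ℝ) < 2) hs1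
  have hc : ContinuousAt (fun κ : ℝ => 2 - κ - (2 + κ) ^ s) 0 := by
    refine (continuousAt_const.sub continuousAt_id).sub ?_
    exact (continuousAt_const.add continuousAt_id).rpow_const (Or.inl (by norm_num))
  have h1 : ∀ᶠ κ in nhdsWithin (0 : ℝ) (Ioi 0), 0 < 2 - κ - (2 + κ) ^ s :=
    (hc.eventually (lt_mem_nhds (show (0 : ℝ) < 2 - 0 - (2 + 0) ^ s by linarith))).filter_mono
      nhdsWithin_le_nhds
  obtain ⟨κ, h2, h3⟩ := (h1.and (Ioo_mem_nhdsGT one_pos)).exists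
  exact ⟨κ, h3.1, h3.2, by linarith⟩

namespace GraphChart

variable {n : ℕ} {Ω : Set (E n)} {x₀ e : E n} {d : E n → ℝ} {K : NNReal} {r : ℝ}

/-- The average over `z` of the oscillation of `w` between `x` and its vertical translates
`x + d(x) (e + z)` is controlled by the Gagliardo seminorm. -/
lemma lintegral_oscillation_le (h : GraphChart Ω x₀ e d K r) (hΩ : MeasurableSet Ω) {s : ℝ}
    (hs : 0 < s) {w : E n → ℝ} (hw : Measurable w) {ε : ℝ} (hε1 : ε < 1)
    {S : Set (E n)} (hS : MeasurableSet S) (hSΩ : S ⊆ Ω) (hpos : ∀ x ∈ S, 0 < d x)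
    (hmaps : ∀ x ∈ S, ∀ z ∈ Metric.ball (0 : E n) ε, x + d x • (e + z) ∈ Ω) :
    ∫⁻ z in Metric.ball (0 : E n) ε, ∫⁻ x in S,
        ENNReal.ofReal (|w x - w (x + d x • (e + z))| * d x ^ (-s)) ≤
      ENNReal.ofReal (2 ^ ((n : ℝ) + s)) * gagliardo s Ω w := by
  have hd : Continuous d := h.lip.continuous
  have hdm : Measurable d := hd.measurable
  rw [lintegral_lintegral_swap]
  swap
  · refine Measurable.aemeasurable ?_
    unfold Function.uncurry
    have h1 : Measurable fun p : E n × E n => w (p.2 + d p.2 • (e + p.1)) :=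
      hw.comp (by fun_prop)
    have h2 : Measurable fun p : E n × E n => w p.2 := hw.comp measurable_snd
    have h3 : Measurable fun p : E n × E n => d p.2 := hdm.comp measurable_snd
    exact (((h2.sub h1).abs).mul (h3.pow_const _)).ennreal_ofReal
  unfold gagliardo
  rw [← lintegral_const_mul']
  swap
  · exact ENNReal.ofReal_ne_top
  refine (setLIntegral_mono' hS fun x hx => ?_).trans (lintegral_mono_set hSΩ)
  have hdx := hpos x hx
  let k : E n → ℝ≥0∞ := Ω.indicator fun y => ENNReal.ofReal (|w x - w y| / ‖x - y‖ ^ ((n : ℝ) + s))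
  have hk : Measurable k := by
    refine Measurable.indicator ?_ hΩ
    fun_prop
  have hpt : ∀ z ∈ Metric.ball (0 : E n) ε,
      ENNReal.ofReal (|w x - w (x + d x • (e + z))| * d x ^ (-s)) ≤
      ENNReal.ofReal (2 ^ ((n : ℝ) + s) * d x ^ n) * k (x + d x • (e + z)) := by
    intro z hz
    simp only [k]
    rw [indicator_of_mem (hmaps x hx z hz), ← ENNReal.ofReal_mul (by positivity)]
    refine ENNReal.ofReal_le_ofReal ?_
    rw [mem_ball_zero_iff] at hz
    have hn1 : ‖x - (x + d x • (e + z))‖ = d x * ‖e + z‖ := by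
      rw [sub_add_cancel_left, norm_neg, norm_smul, Real.norm_of_nonneg hdx.le]
    have hu : ‖e + z‖ ≤ 2 := by
      have := norm_add_le e z
      rw [h.norm_dir] at this; linarith
    have hl : 0 < ‖e + z‖ := by
      have := norm_sub_norm_le e (-z)
      rw [h.norm_dir, norm_neg, sub_neg_eq_add] at this; linarith
    rw [hn1, Real.mul_rpow hdx.le hl.le, Real.rpow_neg hdx.le, Real.rpow_add hdx, Real.rpow_natCast]
    have hp : ‖e + z‖ ^ ((n : ℝ) + s) ≤ 2 ^ ((n : ℝ) + s) := by gcongr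
    have hq : 0 < ‖e + z‖ ^ ((n : ℝ) + s) := by positivity
    have hds : 0 < d x ^ s := by positivity
    have hdn : 0 < d x ^ n := by positivity
    rw [show (2 : ℝ) ^ ((n : ℝ) + s) * d x ^ n * (|w x - w (x + d x • (e + z))| /
        (d x ^ n * d x ^ s * ‖e + z‖ ^ ((n : ℝ) + s))) =
        |w x - w (x + d x • (e + z))| * (d x ^ s)⁻¹ *
          (2 ^ ((n : ℝ) + s) / ‖e + z‖ ^ ((n : ℝ) + s)) by field_simp]
    exact le_mul_of_one_le_right (by positivity) ((one_le_div hq).2 hp)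
  calc _ ≤ ∫⁻ z in Metric.ball (0 : E n) ε, ENNReal.ofReal (2 ^ ((n : ℝ) + s) * d x ^ n) *
        k (x + d x • (e + z)) := setLIntegral_mono' measurableSet_ball hpt
    _ ≤ ∫⁻ z, ENNReal.ofReal (2 ^ ((n : ℝ) + s) * d x ^ n) * k (x + d x • (e + z)) :=
        setLIntegral_le_lintegral _ _
    _ = ENNReal.ofReal (2 ^ ((n : ℝ) + s) * d x ^ n) * ∫⁻ z, k ((x + d x • e) + d x • z) := by
        rw [lintegral_const_mul' _ _ ENNReal.ofReal_ne_top]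
        simp only [smul_add, add_assoc]
    _ = ENNReal.ofReal (2 ^ ((n : ℝ) + s) * d x ^ n) *
          (ENNReal.ofReal (d x ^ n)⁻¹ * ∫⁻ y, k y) := by
        rw [lintegral_comp_smul volume (f := fun z => k ((x + d x • e) + z))
          (hk.comp (measurable_const_add _)) hdx.ne', lintegral_add_left_eq_self k, finrank_E,
          abs_of_pos (by positivity)]
    _ = ENNReal.ofReal (2 ^ ((n : ℝ) + s)) * ∫⁻ y, k y := by
        rw [← mul_assoc, ← ENNReal.ofReal_mul (by positivity), mul_assoc,
          mul_inv_cancel₀ (by positivity), mul_one]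
    _ = _ := by rw [lintegral_indicator hΩ]

/-- Local Hardy inequality in qualitative form: a function of finite `W^{s,1}`-norm is integrable
against the power `-s` of the height over the boundary graph.

The weighted integral `X` of the function times a cutoff is compared with itself along the maps
`x ↦ x + d(x) (e + z)`, `‖z‖ < ε`. These roughly double the height, which costs a factor `2^s`
in the weight, and roughly double volumes, which gains a factor `2`. As `s < 1`, the result is
`X ≤ θ X + C` with `θ < 1`, up to an oscillation that is averaged over `z`. The weight is cut at
height `η` in order that `X` be finite. -/
lemma lintegral_height_rpow_lt_top (h : GraphChart Ω x₀ e d K r) (hΩ : MeasurableSet Ω)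
    (hx₀ : x₀ ∉ Ω) {s : ℝ} (hs : 0 < s) (hs1 : s < 1) {w : E n → ℝ} (hw : Measurable w)
    (hw0 : ∀ x, 0 ≤ w x) (hint : ∫⁻ x in Ω, ENNReal.ofReal (w x) < ∞)
    (hgag : gagliardo s Ω w < ∞) :
    ∃ ρ : ℝ, 0 < ρ ∧ ρ ≤ r / 2 ∧ ∫⁻ x in Ω ∩ Metric.ball x₀ ρ,
      ENNReal.ofReal (w x) * ENNReal.ofReal (d x ^ (-s)) < ∞ := by
  obtain ⟨κ, hκ0, hκ1, hκ⟩ := exists_rpow_two_add_lt hs1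
  have hK : (0 : ℝ) < K := h.lip_pos
  have hd : Continuous d := h.lip.continuous
  have hr := h.radius_pos
  -- the opening `ε` of the cone of directions and the radius `ρ` of the neighbourhood
  obtain ⟨ε, hε0, hε1, hεκ⟩ : ∃ ε : ℝ, 0 < ε ∧ ε < 1 ∧ K * ε ≤ κ :=
    ⟨min (1 / 2) (κ / K), by positivity, by
      linarith [min_le_left (1 / 2 : ℝ) (κ / K)], by
      calc K * min (1 / 2) (κ / K) ≤ K * (κ / K) := by gcongr; exact min_le_right _ _
        _ = κ := by field_simp⟩
  obtain ⟨ρ, hρ0, hρ1, hρK, hρr⟩ : ∃ ρ : ℝ, 0 < ρ ∧ 2 * ρ ≤ 1 ∧ K * (2 * ρ) ≤ 1 ∧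
      2 * ρ + 2 * (K * (2 * ρ)) ≤ r := by
    refine ⟨min r 1 / (1 + 2 * K) / 2, by positivity, ?_, ?_, ?_⟩
    · rw [mul_div_cancel₀ _ two_ne_zero, div_le_one (by positivity)]
      linarith [min_le_right r 1]
    · rw [mul_div_cancel₀ _ two_ne_zero, mul_div_assoc', div_le_one (by positivity)]
      nlinarith [min_le_right r 1]
    · rw [mul_div_cancel₀ _ two_ne_zero]
      have : min r 1 / (1 + 2 * K) + 2 * (K * (min r 1 / (1 + 2 * K))) = min r 1 := by field_simp
      rw [this]; exact min_le_left _ _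
  have hρr' : 2 * ρ ≤ r := by nlinarith
  refine ⟨ρ, hρ0, by linarith, ?_⟩
  let χ : E n → ℝ := fun x => max (2 * ρ - ‖x - x₀‖) 0
  have hχc : Continuous χ := by fun_prop
  have hχ0 : ∀ x, 0 ≤ χ x := fun x => le_max_right _ _
  have hχ1 : ∀ x, χ x ≤ 1 := fun x => max_le (by linarith [norm_nonneg (x - x₀)]) zero_le_one
  have hχlip : ∀ x y, χ x - χ y ≤ ‖x - y‖ := by
    intro x y
    have h1 : ‖y - x₀‖ ≤ ‖x - y‖ + ‖x - x₀‖ := by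
      have := norm_sub_le (x - x₀) (x - y)
      rw [sub_sub_sub_cancel_left] at this
      linarith
    have h2 := norm_nonneg (x - y)
    have : χ x ≤ χ y + ‖x - y‖ := by
      refine max_le ?_ (add_nonneg (hχ0 y) h2)
      have := le_max_left (2 * ρ - ‖y - x₀‖) 0
      simp only [χ]; linarith
    linarith
  let S : ℝ → Set (E n) := fun η => Metric.ball x₀ (2 * ρ) ∩ {x | η < d x}
  have hSm : ∀ η, MeasurableSet (S η) := fun η =>
    measurableSet_ball.inter (measurableSet_lt measurable_const hd.measurable)
  have hdS : ∀ η, ∀ x ∈ S η, d x ≤ K * (2 * ρ) := fun η x hx => by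
    refine (h.height_le hx₀ x).trans ?_
    have : ‖x - x₀‖ < 2 * ρ := by simpa [dist_eq_norm] using hx.1
    gcongr
  have hSΩ : ∀ η, 0 ≤ η → S η ⊆ Ω := fun η hη x hx =>
    (h.mem_iff x (Metric.ball_subset_ball hρr' hx.1)).2 (hη.trans_lt hx.2)
  -- heights along the maps `x ↦ x + d x • (e + z)`
  have hheight : ∀ x z, 0 ≤ d x → z ∈ Metric.ball (0 : E n) ε →
      |d (x + d x • (e + z)) - (d x + d x)| ≤ κ * d x := by
    intro x z hx hz
    refine (h.abs_height_add_smul_sub_le x z hx).trans ?_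
    have : ‖z‖ ≤ ε := (mem_ball_zero_iff.1 hz).le
    gcongr
    exact (by gcongr : (K : ℝ) * ‖z‖ ≤ K * ε).trans hεκ
  have hnorm : ∀ z ∈ Metric.ball (0 : E n) ε, ‖e + z‖ ≤ 2 := by
    intro z hz
    have h1 := norm_add_le e z
    have := mem_ball_zero_iff.1 hz
    rw [h.norm_dir] at h1; linarith
  have hmaps : ∀ η, 0 ≤ η → ∀ x ∈ S η, ∀ z ∈ Metric.ball (0 : E n) ε,
      x + d x • (e + z) ∈ Ω := by
    intro η hη x hx z hz
    have hdx : 0 < d x := hη.trans_lt hx.2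
    have h1 := (abs_le.1 (hheight x z hdx.le hz)).1
    refine (h.mem_iff _ ?_).2 (by nlinarith)
    rw [Metric.mem_ball, dist_eq_norm, add_sub_right_comm]
    have h2 : ‖x - x₀‖ < 2 * ρ := by simpa [dist_eq_norm] using hx.1
    have h3 : ‖d x • (e + z)‖ ≤ K * (2 * ρ) * 2 := by
      rw [norm_smul, Real.norm_of_nonneg hdx.le]
      exact mul_le_mul (hdS η x hx) (hnorm z hz) (norm_nonneg _) (by positivity)
    linarith [norm_add_le (x - x₀) (d x • (e + z))]
  let f : E n → ℝ≥0∞ := fun x => ENNReal.ofReal (w x * χ x * d x ^ (-s))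
  have hfm : Measurable f := by
    have := hd.measurable
    have := hχc.measurable
    fun_prop
  let X : ℝ → ℝ≥0∞ := fun η => ∫⁻ x in S η, f x
  let A : ℝ≥0∞ := ∫⁻ x in Ω, ENNReal.ofReal (w x)
  let b : ℝ≥0∞ := volume (Metric.ball (0 : E n) ε)
  have hb0 : b ≠ 0 := (Metric.measure_ball_pos _ _ hε0).ne'
  have hbtop : b ≠ ∞ := measure_ball_lt_top.ne
  have hXfin : ∀ η, 0 < η → X η < ∞ := by
    intro η hη
    calc X η ≤ ∫⁻ x in S η, ENNReal.ofReal (η ^ (-s)) * ENNReal.ofReal (w x) := by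
          refine setLIntegral_mono' (hSm η) fun x hx => ?_
          rw [← ENNReal.ofReal_mul (by positivity)]
          refine ENNReal.ofReal_le_ofReal ?_
          have h1 : d x ^ (-s) ≤ η ^ (-s) :=
            Real.rpow_le_rpow_of_nonpos hη hx.2.le (by linarith)
          have h2 : 0 ≤ d x ^ (-s) := Real.rpow_nonneg (hη.trans hx.2).le _
          have h3 : w x * χ x ≤ w x := mul_le_of_le_one_right (hw0 x) (hχ1 x)
          rw [mul_comm]
          exact mul_le_mul h1 h3 (mul_nonneg (hw0 x) (hχ0 x)) (by positivity)
      _ = ENNReal.ofReal (η ^ (-s)) * ∫⁻ x in S η, ENNReal.ofReal (w x) :=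
          lintegral_const_mul' _ _ ENNReal.ofReal_ne_top
      _ ≤ ENNReal.ofReal (η ^ (-s)) * A := by gcongr; exact lintegral_mono_set (hSΩ η hη.le)
      _ < ∞ := ENNReal.mul_lt_top ENNReal.ofReal_lt_top hint
  let θ : ℝ := (2 + κ) ^ s / (2 - κ)
  have hθ0 : 0 ≤ θ := div_nonneg (by positivity) (by linarith)
  have hθ1 : θ < 1 := (div_lt_one (by linarith)).2 hκ
  let B : ℝ≥0∞ := ENNReal.ofReal 2 * A + ENNReal.ofReal (2 ^ ((n : ℝ) + s)) * gagliardo s Ω w / b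
  have hB : B < ∞ := ENNReal.add_lt_top.2 ⟨ENNReal.mul_lt_top ENNReal.ofReal_lt_top hint,
    ENNReal.div_lt_top (ENNReal.mul_lt_top ENNReal.ofReal_lt_top hgag).ne hb0⟩
  have hstep : ∀ η, 0 < η → X η ≤ ENNReal.ofReal θ * X η + B := by
    intro η hη
    let F : E n → ℝ≥0∞ := (S η).indicator f
    have hpt : ∀ z ∈ Metric.ball (0 : E n) ε, ∀ x ∈ S η, f x ≤
        ENNReal.ofReal ((2 + κ) ^ s) * F (x + d x • (e + z)) +
        (ENNReal.ofReal 2 * ENNReal.ofReal (w x) +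
          ENNReal.ofReal (|w x - w (x + d x • (e + z))| * d x ^ (-s))) := by
      intro z hz x hx
      have hdx : 0 < d x := hη.trans hx.2
      set y := x + d x • (e + z) with hy
      have hyh := abs_le.1 (hheight x z hdx.le hz)
      rw [← hy] at hyh
      have hdy : η < d y := by
        have : d x ≤ d y := by nlinarith
        exact hx.2.trans_le this
      have hF : F y = f y := by
        by_cases hyS : y ∈ S η
        · exact indicator_of_mem hyS _
        · rw [show F y = 0 from indicator_of_notMem hyS _]
          have : χ y = 0 := by
            refine max_eq_right ?_
            by_contra! hlt
            exact hyS ⟨by rw [Metric.mem_ball, dist_eq_norm]; linarith, hdy⟩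
          simp [f, this]
      rw [hF, ← ENNReal.ofReal_mul (by positivity), ← ENNReal.ofReal_mul (by norm_num),
        ← ENNReal.ofReal_add, ← ENNReal.ofReal_add]
      rotate_left
      · exact mul_nonneg (by positivity) (mul_nonneg (mul_nonneg (hw0 _) (hχ0 _))
          (Real.rpow_nonneg (hη.trans hdy).le _))
      · have := hw0 x; positivity
      · have := hw0 x; positivity
      · positivity
      refine ENNReal.ofReal_le_ofReal ?_
      have hyx : ‖x - y‖ ≤ 2 * d x := by
        rw [hy, sub_add_cancel_left, norm_neg, norm_smul, Real.norm_of_nonneg hdx.le, mul_comm]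
        gcongr
        exact hnorm z hz
      have h1 : d x ^ (-s) ≤ (2 + κ) ^ s * d y ^ (-s) := by
        have h2 : ((2 + κ) * d x) ^ (-s) ≤ d y ^ (-s) :=
          Real.rpow_le_rpow_of_nonpos (hη.trans hdy) (by linarith) (by linarith)
        rw [Real.mul_rpow (by positivity) hdx.le] at h2
        calc d x ^ (-s) = (2 + κ) ^ s * ((2 + κ) ^ (-s) * d x ^ (-s)) := by
              rw [← mul_assoc, ← Real.rpow_add (by positivity), add_neg_cancel, Real.rpow_zero,
                one_mul]
          _ ≤ _ := by gcongr
      have h2 : d x * d x ^ (-s) ≤ 1 := by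
        rw [← Real.rpow_one_add' hdx.le (by linarith)]
        exact Real.rpow_le_one hdx.le ((hdS η x hx).trans hρK) (by linarith)
      have hds : 0 ≤ d x ^ (-s) := by positivity
      have h3 : w x * (χ x - χ y) * d x ^ (-s) ≤ 2 * w x := by
        calc w x * (χ x - χ y) * d x ^ (-s) ≤ w x * (2 * d x) * d x ^ (-s) := by
              gcongr
              · exact hw0 x
              · exact (hχlip x y).trans hyx
          _ = 2 * w x * (d x * d x ^ (-s)) := by ring
          _ ≤ 2 * w x * 1 := by gcongr; exact mul_nonneg zero_le_two (hw0 x)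
          _ = _ := mul_one _
      have h4 : (w x - w y) * χ y * d x ^ (-s) ≤ |w x - w y| * d x ^ (-s) := by
        gcongr
        calc (w x - w y) * χ y ≤ |w x - w y| * χ y := by
              gcongr
              exact le_abs_self _
          _ ≤ |w x - w y| := mul_le_of_le_one_right (abs_nonneg _) (hχ1 y)
      have h5 : w y * χ y * d x ^ (-s) ≤ (2 + κ) ^ s * (w y * χ y * d y ^ (-s)) := by
        calc w y * χ y * d x ^ (-s) ≤ w y * χ y * ((2 + κ) ^ s * d y ^ (-s)) := by
              gcongr
              exact mul_nonneg (hw0 y) (hχ0 y)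
          _ = _ := by ring
      have : w x * χ x * d x ^ (-s) = w y * χ y * d x ^ (-s) +
        (w x * (χ x - χ y) * d x ^ (-s) + (w x - w y) * χ y * d x ^ (-s)) := by ring
      rw [this]
      gcongr
    have hz : ∀ z ∈ Metric.ball (0 : E n) ε, X η ≤ ENNReal.ofReal θ * X η +
        (ENNReal.ofReal 2 * A + ∫⁻ x in S η,
          ENNReal.ofReal (|w x - w (x + d x • (e + z))| * d x ^ (-s))) := by
      intro z hz
      have hdm := hd.measurable
      have hFm : Measurable F := hfm.indicator (hSm η)
      have hTm : Measurable fun x => x + d x • (e + z) := by fun_prop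
      have hmono : ∀ x t, 0 ≤ t → (1 - κ) * t ≤ d (x + t • (e + z)) - d x := by
        intro x t ht
        have h1 := (abs_le.1 (h.abs_height_add_smul_sub_le x z ht)).1
        have h2 : K * ‖z‖ * t ≤ κ * t := by
          have : ‖z‖ ≤ ε := (mem_ball_zero_iff.1 hz).le
          gcongr
          exact (by gcongr : (K : ℝ) * ‖z‖ ≤ K * ε).trans hεκ
        linarith
      have hcv : ∫⁻ x, F (x + d x • (e + z)) ≤ ENNReal.ofReal (2 - κ)⁻¹ * X η := by
        have h1 := lintegral_comp_add_smul_le volume h.lip (e + z) (by linarith) hmono F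
        rw [show 1 + (1 - κ) = 2 - κ by ring, lintegral_indicator (hSm η)] at h1
        calc ∫⁻ x, F (x + d x • (e + z))
            = ENNReal.ofReal (2 - κ)⁻¹ * (ENNReal.ofReal (2 - κ) *
                ∫⁻ x, F (x + d x • (e + z))) := by
              rw [← mul_assoc, ← ENNReal.ofReal_mul (inv_nonneg.2 (by linarith)),
                inv_mul_cancel₀ (by linarith), ENNReal.ofReal_one, one_mul]
          _ ≤ _ := by gcongr
      calc X η ≤ ∫⁻ x in S η, (ENNReal.ofReal ((2 + κ) ^ s) * F (x + d x • (e + z)) +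
            (ENNReal.ofReal 2 * ENNReal.ofReal (w x) +
              ENNReal.ofReal (|w x - w (x + d x • (e + z))| * d x ^ (-s)))) :=
            setLIntegral_mono' (hSm η) (hpt z hz)
        _ = ENNReal.ofReal ((2 + κ) ^ s) * (∫⁻ x in S η, F (x + d x • (e + z))) +
            (ENNReal.ofReal 2 * (∫⁻ x in S η, ENNReal.ofReal (w x)) + ∫⁻ x in S η,
              ENNReal.ofReal (|w x - w (x + d x • (e + z))| * d x ^ (-s))) := by
            rw [lintegral_add_left (by exact (hFm.comp hTm).const_mul _),
              lintegral_add_left (hw.ennreal_ofReal.const_mul _),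
              lintegral_const_mul' _ _ ENNReal.ofReal_ne_top,
              lintegral_const_mul' _ _ ENNReal.ofReal_ne_top]
        _ ≤ _ := by
            refine add_le_add ?_ (add_le_add (mul_le_mul' le_rfl ?_) le_rfl)
            · calc ENNReal.ofReal ((2 + κ) ^ s) * (∫⁻ x in S η, F (x + d x • (e + z)))
                  ≤ ENNReal.ofReal ((2 + κ) ^ s) * (ENNReal.ofReal (2 - κ)⁻¹ * X η) := by
                    gcongr
                    exact (setLIntegral_le_lintegral _ _).trans hcv
                _ = _ := by
                    rw [← mul_assoc, ← ENNReal.ofReal_mul (by positivity), ← div_eq_mul_inv]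
            · exact lintegral_mono_set (hSΩ η hη.le)
    have havg : b * X η ≤ b * (ENNReal.ofReal θ * X η + B) := by
      calc b * X η = ∫⁻ z in Metric.ball (0 : E n) ε, X η := by
            rw [setLIntegral_const, mul_comm]
        _ ≤ ∫⁻ z in Metric.ball (0 : E n) ε, (ENNReal.ofReal θ * X η + ENNReal.ofReal 2 * A +
              ∫⁻ x in S η, ENNReal.ofReal (|w x - w (x + d x • (e + z))| * d x ^ (-s))) :=
            setLIntegral_mono' measurableSet_ball fun z hz' => by
              rw [add_assoc]; exact hz z hz'
        _ = b * (ENNReal.ofReal θ * X η + ENNReal.ofReal 2 * A) +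
              ∫⁻ z in Metric.ball (0 : E n) ε, ∫⁻ x in S η,
                ENNReal.ofReal (|w x - w (x + d x • (e + z))| * d x ^ (-s)) := by
            rw [lintegral_add_left measurable_const, setLIntegral_const, mul_comm]
        _ ≤ b * (ENNReal.ofReal θ * X η + ENNReal.ofReal 2 * A) +
              ENNReal.ofReal (2 ^ ((n : ℝ) + s)) * gagliardo s Ω w := by
            gcongr
            exact h.lintegral_oscillation_le hΩ hs hw hε1 (hSm η) (hSΩ η hη.le)
              (fun x hx => hη.trans hx.2) (hmaps η hη.le)
        _ = _ := by
            rw [show B = ENNReal.ofReal 2 * A +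
              ENNReal.ofReal (2 ^ ((n : ℝ) + s)) * gagliardo s Ω w / b from rfl,
              ← add_assoc, mul_add b _ (_ / b), ENNReal.mul_div_cancel hb0 hbtop]
    exact (ENNReal.mul_le_mul_iff_right hb0 hbtop).1 havg
  -- absorb the first term on the right
  have hbound : ∀ η, 0 < η → X η ≤ ENNReal.ofReal (B.toReal / (1 - θ)) := by
    intro η hη
    have h1 := ENNReal.toReal_mono (ENNReal.add_lt_top.2
      ⟨ENNReal.mul_lt_top ENNReal.ofReal_lt_top (hXfin η hη), hB⟩).ne (hstep η hη)
    rw [ENNReal.toReal_add (ENNReal.mul_lt_top ENNReal.ofReal_lt_top (hXfin η hη)).ne hB.ne,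
      ENNReal.toReal_mul, ENNReal.toReal_ofReal hθ0] at h1
    rw [← ENNReal.ofReal_toReal (hXfin η hη).ne]
    refine ENNReal.ofReal_le_ofReal ?_
    rw [le_div_iff₀ (by linarith)]
    linarith
  have hX0 : X 0 ≤ ENNReal.ofReal (B.toReal / (1 - θ)) := by
    have hU : S 0 = ⋃ k : ℕ, S (1 / ((k : ℝ) + 1)) := by
      ext x
      simp only [S, mem_inter_iff, mem_iUnion, mem_ofPred_eq, exists_and_left, and_congr_right_iff]
      intro _
      refine ⟨fun hx => exists_nat_one_div_lt hx, fun ⟨k, hk⟩ => lt_trans (by positivity) hk⟩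
    have hmono : Monotone fun k : ℕ => S (1 / ((k : ℝ) + 1)) := by
      intro i j hij x hx
      have h1 : 1 / ((i : ℝ) + 1) < d x := hx.2
      exact ⟨hx.1, lt_of_le_of_lt (one_div_le_one_div_of_le (by positivity)
        (by exact_mod_cast Nat.succ_le_succ hij)) h1⟩
    simp only [X]
    rw [hU, setLIntegral_iUnion_of_directed _ hmono.directed_le]
    exact iSup_le fun k => hbound _ (by positivity)
  calc ∫⁻ x in Ω ∩ Metric.ball x₀ ρ, ENNReal.ofReal (w x) * ENNReal.ofReal (d x ^ (-s))
      ≤ ∫⁻ x in S 0, ENNReal.ofReal ρ⁻¹ * f x := by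
        have hsub : Ω ∩ Metric.ball x₀ ρ ⊆ S 0 := fun x hx =>
          ⟨Metric.ball_subset_ball (by linarith) hx.2,
            (h.mem_iff x (Metric.ball_subset_ball (by linarith) hx.2)).1 hx.1⟩
        refine (setLIntegral_mono' (hΩ.inter measurableSet_ball) fun x hx => ?_).trans
          (lintegral_mono_set hsub)
        have hχρ : ρ ≤ χ x := by
          refine le_trans ?_ (le_max_left _ _)
          have : ‖x - x₀‖ < ρ := by simpa [dist_eq_norm] using hx.2
          linarith
        have hdx : 0 < d x := (hsub hx).2
        rw [← ENNReal.ofReal_mul (hw0 x), ← ENNReal.ofReal_mul (by positivity)]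
        refine ENNReal.ofReal_le_ofReal ?_
        have h1 : 1 ≤ ρ⁻¹ * χ x := by
          rw [← inv_mul_cancel₀ hρ0.ne']; gcongr
        calc w x * d x ^ (-s) ≤ w x * d x ^ (-s) * (ρ⁻¹ * χ x) :=
              le_mul_of_one_le_right (mul_nonneg (hw0 x) (by positivity)) h1
          _ = _ := by ring
    _ = ENNReal.ofReal ρ⁻¹ * X 0 := lintegral_const_mul' _ _ ENNReal.ofReal_ne_top
    _ < ∞ := ENNReal.mul_lt_top ENNReal.ofReal_lt_top (hX0.trans_lt ENNReal.ofReal_lt_top)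

end GraphChart

/-- The interaction `∫_{Ωᶜ} |x - y|^{-n-s} dy` of a point `x` with the complement of `Ω`. -/
def extMass {n : ℕ} (s : ℝ) (Ω : Set (E n)) (x : E n) : ℝ≥0∞ :=
  ∫⁻ y in Ωᶜ, ENNReal.ofReal (1 / ‖x - y‖ ^ ((n : ℝ) + s))

lemma measurable_extMass {n : ℕ} (s : ℝ) (Ω : Set (E n)) : Measurable (extMass s Ω) := by
  refine Measurable.lintegral_prod_right' (f := fun p : E n × E n =>
    ENNReal.ofReal (1 / ‖p.1 - p.2‖ ^ ((n : ℝ) + s))) ?_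
  fun_prop

lemma extMass_le {n : ℕ} {s : ℝ} (hn : 1 ≤ n) (hs : 0 < s) {Ω : Set (E n)} {x : E n} {R : ℝ}
    (hR : 0 < R) (h : ∀ y ∉ Ω, R ≤ ‖x - y‖) :
    extMass s Ω x ≤ ENNReal.ofReal (kernelMass n s * R ^ (-s)) := by
  rw [← lintegral_kernel_tail hn hs x hR]
  exact lintegral_mono_set fun y hy => h y hy

lemma extMass_lt_top {n : ℕ} {s : ℝ} (hn : 1 ≤ n) (hs : 0 < s) {Ω : Set (E n)} (hΩ : IsOpen Ω)
    {x : E n} (hx : x ∈ Ω) : extMass s Ω x < ∞ := by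
  obtain ⟨R, hR, hball⟩ := Metric.isOpen_iff.1 hΩ x hx
  refine (extMass_le hn hs hR fun y hy => ?_).trans_lt ENNReal.ofReal_lt_top
  by_contra! hlt
  exact hy (hball (by rwa [Metric.mem_ball, dist_eq_norm, norm_sub_rev]))

lemma gagliardo_congr_ae {n : ℕ} {s : ℝ} {Ω : Set (E n)} {u v : E n → ℝ}
    (h : u =ᵐ[volume.restrict Ω] v) : gagliardo s Ω u = gagliardo s Ω v := by
  refine lintegral_congr_ae ?_
  filter_upwards [h] with x hx
  refine lintegral_congr_ae ?_
  filter_upwards [h] with y hy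
  rw [hx, hy]

lemma gagliardo_abs_le {n : ℕ} {s : ℝ} {Ω : Set (E n)} (u : E n → ℝ) :
    gagliardo s Ω (fun x => |u x|) ≤ gagliardo s Ω u := by
  refine lintegral_mono fun x => lintegral_mono fun y => ENNReal.ofReal_le_ofReal ?_
  exact div_le_div_of_nonneg_right (abs_abs_sub_abs_le (u x) (u y)) (by positivity)

/-- Fractional Hardy inequality, in qualitative form: on a bounded Lipschitz domain, functions of
class `W^{s,1}` with `s < 1` have finite interaction with the complement of the domain. -/
lemma lintegral_mul_extMass_lt_top {n : ℕ} {s : ℝ} (hn : 1 ≤ n) (hs : 0 < s) (hs1 : s < 1)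
    {Ω : Set (E n)} (hΩ : IsOpen Ω) (hb : Bornology.IsBounded Ω) (hL : HasLipschitzBoundary Ω)
    {u : E n → ℝ} (hu : u ∈ W s Ω) :
    ∫⁻ x in Ω, ENNReal.ofReal |u x| * extMass s Ω x < ∞ := by
  obtain ⟨huL, hug⟩ := hu
  let u' := huL.1.mk u
  have hu' : Measurable u' := huL.1.stronglyMeasurable_mk.measurable
  have hae : u =ᵐ[volume.restrict Ω] u' := huL.1.ae_eq_mk
  let w : E n → ℝ := fun x => |u' x|
  have hw : Measurable w := hu'.abs
  have hw0 : ∀ x, 0 ≤ w x := fun x => abs_nonneg _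
  have hwg : gagliardo s Ω w < ∞ := by
    refine (gagliardo_abs_le u').trans_lt ?_
    rwa [← gagliardo_congr_ae hae]
  have hwi : ∫⁻ x in Ω, ENNReal.ofReal (w x) < ∞ := by
    have h1 := (memLp_one_iff_integrable.1 huL).2
    rw [hasFiniteIntegral_iff_norm] at h1
    refine lt_of_eq_of_lt (lintegral_congr_ae ?_) h1
    filter_upwards [hae] with x hx
    rw [hx, Real.norm_eq_abs]
  have hcongr : ∫⁻ x in Ω, ENNReal.ofReal |u x| * extMass s Ω x =
      ∫⁻ x in Ω, ENNReal.ofReal (w x) * extMass s Ω x := by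
    refine lintegral_congr_ae ?_
    filter_upwards [hae] with x hx
    rw [hx]
  rw [hcongr]
  let ν : Measure (E n) :=
    (volume.restrict Ω).withDensity fun x => ENNReal.ofReal (w x) * extMass s Ω x
  have hν : ∀ x₀ ρ, ν (Metric.ball x₀ ρ) =
      ∫⁻ x in Ω ∩ Metric.ball x₀ ρ, ENNReal.ofReal (w x) * extMass s Ω x := by
    intro x₀ ρ
    rw [withDensity_apply _ measurableSet_ball, Measure.restrict_restrict measurableSet_ball,
      inter_comm]
  have hfin : ν (closure Ω) < ∞ := by
    refine (hb.isCompact_closure).measure_lt_top_of_nhdsWithin fun x₀ hx₀ => ?_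
    suffices ∃ ρ > 0, ν (Metric.ball x₀ ρ) < ∞ by
      obtain ⟨ρ, hρ, h⟩ := this
      exact ⟨_, mem_nhdsWithin_of_mem_nhds (Metric.ball_mem_nhds x₀ hρ), h⟩
    by_cases hxΩ : x₀ ∈ Ω
    · obtain ⟨R, hR, hball⟩ := Metric.isOpen_iff.1 hΩ x₀ hxΩ
      refine ⟨R / 2, by positivity, ?_⟩
      rw [hν]
      calc _ ≤ ∫⁻ x in Ω ∩ Metric.ball x₀ (R / 2),
            ENNReal.ofReal (w x) * ENNReal.ofReal (kernelMass n s * (R / 2) ^ (-s)) := by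
            refine setLIntegral_mono' (hΩ.measurableSet.inter measurableSet_ball) fun x hx => ?_
            refine mul_le_mul' le_rfl (extMass_le hn hs (by positivity) fun y hy => ?_)
            by_contra! hlt
            refine hy (hball ?_)
            have h1 := Metric.mem_ball.1 hx.2
            rw [← dist_eq_norm, dist_comm] at hlt
            exact Metric.mem_ball.2 (by linarith [dist_triangle y x x₀])
        _ = (∫⁻ x in Ω ∩ Metric.ball x₀ (R / 2), ENNReal.ofReal (w x)) *
            ENNReal.ofReal (kernelMass n s * (R / 2) ^ (-s)) :=
            lintegral_mul_const' _ _ ENNReal.ofReal_ne_top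
        _ < ∞ := ENNReal.mul_lt_top ((lintegral_mono_set inter_subset_left).trans_lt hwi)
            ENNReal.ofReal_lt_top
    · have hfr : x₀ ∈ frontier Ω := by
        rw [hΩ.frontier_eq]; exact ⟨hx₀, hxΩ⟩
      obtain ⟨e, d, K, r, h⟩ := hL.exists_graphChart hfr
      obtain ⟨ρ, hρ, hρr, hlt⟩ :=
        h.lintegral_height_rpow_lt_top hΩ.measurableSet hxΩ hs hs1 hw hw0 hwi hwg
      refine ⟨ρ, hρ, ?_⟩
      rw [hν]
      have hK : (0 : ℝ) < K := h.lip_pos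
      calc _ ≤ ∫⁻ x in Ω ∩ Metric.ball x₀ ρ, ENNReal.ofReal (w x) * ENNReal.ofReal (d x ^ (-s)) *
            ENNReal.ofReal (kernelMass n s * (K : ℝ)⁻¹ ^ (-s)) := by
            refine setLIntegral_mono' (hΩ.measurableSet.inter measurableSet_ball) fun x hx => ?_
            have hxr : x ∈ Metric.ball x₀ r :=
              Metric.ball_subset_ball (by linarith [h.radius_pos]) hx.2
            have hdx : 0 < d x := (h.mem_iff x hxr).1 hx.1
            rw [mul_assoc, ← ENNReal.ofReal_mul (by positivity)]
            refine mul_le_mul' le_rfl ((extMass_le hn hs (R := d x * (K : ℝ)⁻¹)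
              (by positivity) fun y hy => ?_).trans (le_of_eq ?_))
            · rw [← div_eq_mul_inv, div_le_iff₀ hK, mul_comm]
              by_cases hyr : y ∈ Metric.ball x₀ r
              · have h1 : d y ≤ 0 := by
                  by_contra! hlt
                  exact hy ((h.mem_iff y hyr).2 hlt)
                linarith [(abs_le.1 (h.abs_height_sub_le x y)).2]
              · refine (h.height_le hxΩ x).trans ?_
                gcongr
                have h1 := Metric.mem_ball.1 hx.2
                rw [Metric.mem_ball, not_lt] at hyr
                rw [← dist_eq_norm, ← dist_eq_norm]
                linarith [dist_triangle y x x₀, dist_comm x y]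
            · rw [Real.mul_rpow hdx.le (by positivity)]
              congr 1; ring
        _ = (∫⁻ x in Ω ∩ Metric.ball x₀ ρ, ENNReal.ofReal (w x) * ENNReal.ofReal (d x ^ (-s))) *
            ENNReal.ofReal (kernelMass n s * (K : ℝ)⁻¹ ^ (-s)) :=
            lintegral_mul_const' _ _ ENNReal.ofReal_ne_top
        _ < ∞ := ENNReal.mul_lt_top hlt ENNReal.ofReal_lt_top
  refine lt_of_le_of_lt ?_ hfin
  rw [withDensity_apply _ isClosed_closure.measurableSet,
    Measure.restrict_restrict isClosed_closure.measurableSet,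
    inter_eq_right.2 subset_closure]

/-- The fractional perimeter of a bounded Lipschitz domain is finite. -/
lemma lintegral_extMass_lt_top {n : ℕ} {s : ℝ} (hn : 1 ≤ n) (hs : 0 < s) (hs1 : s < 1)
    {Ω : Set (E n)} (hΩ : IsOpen Ω) (hb : Bornology.IsBounded Ω) (hL : HasLipschitzBoundary Ω) :
    ∫⁻ x in Ω, extMass s Ω x < ∞ := by
  have : IsFiniteMeasure (volume.restrict Ω) := ⟨by simpa using hb.measure_lt_top⟩
  have h := lintegral_mul_extMass_lt_top hn hs hs1 hΩ hb hL (u := fun _ => 1)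
    ⟨memLp_const 1, by simp [gagliardo]⟩
  simpa using h

/-! ### The direct method for submodular functionals -/

open Filter in
lemma exists_ae_tendsto_of_ae_monotone {X : Type*} [MeasurableSpace X] {μ : Measure X}
    {v : ℕ → X → ℝ} (hv : ∀ k, AEMeasurable (v k) μ) (hmono : ∀ᵐ x ∂μ, Monotone fun k => v k x)
    {M : ℝ≥0∞} (hM : M < ∞) (hbd : ∀ k, ∫⁻ x, ‖v k x‖ₑ ∂μ ≤ M) :
    ∃ w : X → ℝ, ∀ᵐ x ∂μ, Tendsto (fun k => v k x) atTop (nhds (w x)) := by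
  have hfat : ∫⁻ x, liminf (fun k => ‖v k x‖ₑ) atTop ∂μ < ∞ :=
    (lintegral_liminf_le' fun k => (hv k).enorm).trans_lt
      ((liminf_le_of_frequently_le' (Frequently.of_forall hbd)).trans_lt hM)
  have hae : ∀ᵐ x ∂μ, liminf (fun k => ‖v k x‖ₑ) atTop < ∞ :=
    ae_lt_top' (by
      simp only [liminf_eq_iSup_iInf_of_nat]
      exact AEMeasurable.iSup fun k => AEMeasurable.iInf fun i => AEMeasurable.iInf fun _ =>
        (hv i).enorm) hfat.ne
  refine ⟨fun x => limUnder atTop fun k => v k x, ?_⟩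
  filter_upwards [hmono, hae] with x hx hlt
  rcases tendsto_atTop_of_monotone hx with h | ⟨l, h⟩
  · have h1 : Tendsto (fun k => ‖v k x‖ₑ) atTop (nhds ∞) := by
      simp only [Real.enorm_eq_ofReal_abs]
      exact ENNReal.tendsto_ofReal_atTop.comp (tendsto_abs_atTop_atTop.comp h)
    rw [h1.liminf_eq] at hlt
    exact absurd hlt (lt_irrefl _)
  · exact tendsto_nhds_limUnder ⟨l, h⟩

open Filter in
lemma exists_ae_tendsto_of_ae_antitone {X : Type*} [MeasurableSpace X] {μ : Measure X}
    {v : ℕ → X → ℝ} (hv : ∀ k, AEMeasurable (v k) μ) (hmono : ∀ᵐ x ∂μ, Antitone fun k => v k x)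
    {M : ℝ≥0∞} (hM : M < ∞) (hbd : ∀ k, ∫⁻ x, ‖v k x‖ₑ ∂μ ≤ M) :
    ∃ w : X → ℝ, ∀ᵐ x ∂μ, Tendsto (fun k => v k x) atTop (nhds (w x)) := by
  obtain ⟨w, hw⟩ := exists_ae_tendsto_of_ae_monotone (v := fun k x => -v k x)
    (fun k => (hv k).neg) (hmono.mono fun x hx => hx.neg) hM (by simpa using hbd)
  exact ⟨fun x => -w x, hw.mono fun x hx => by simpa using hx.neg⟩

open Filter in
/-- A submodular, coercive functional satisfying Fatou's property on a lattice of functions has a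
minimizer.

No compactness is needed: by submodularity, if the excess of `u j` over the infimum is at most
`2⁻ʲ`, then the excess of `min (u k) … (u (k + m))` is at most `2 · 2⁻ᵏ`. These running minima
decrease in `m`, and their limits increase in `k`, so that the pointwise limits exist. -/
lemma exists_minimizer_of_submodular {X : Type*} [MeasurableSpace X] {μ : Measure X}
    {𝒜 : Set (X → ℝ)} {Φ : (X → ℝ) → ℝ≥0∞}
    (hmeas : ∀ u ∈ 𝒜, AEMeasurable u μ)
    (hinf : ∀ u ∈ 𝒜, ∀ v ∈ 𝒜, u ⊓ v ∈ 𝒜) (hsup : ∀ u ∈ 𝒜, ∀ v ∈ 𝒜, u ⊔ v ∈ 𝒜)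
    (hsub : ∀ u ∈ 𝒜, ∀ v ∈ 𝒜, Φ (u ⊓ v) + Φ (u ⊔ v) ≤ Φ u + Φ v)
    (hlsc : ∀ (v : ℕ → X → ℝ) (w : X → ℝ), (∀ k, v k ∈ 𝒜) →
      (∀ᵐ x ∂μ, Tendsto (fun k => v k x) atTop (nhds (w x))) →
      w ∈ 𝒜 ∧ Φ w ≤ liminf (fun k => Φ (v k)) atTop)
    {c : ℝ≥0∞} (hc : c ≠ 0) (hc' : c ≠ ∞) (hcoer : ∀ u ∈ 𝒜, c * ∫⁻ x, ‖u x‖ₑ ∂μ ≤ Φ u)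
    {u₀ : X → ℝ} (hu₀ : u₀ ∈ 𝒜) (hfin : Φ u₀ < ∞) :
    ∃ u ∈ 𝒜, ∀ v ∈ 𝒜, Φ u ≤ Φ v := by
  let I : ℝ≥0∞ := ⨅ v ∈ 𝒜, Φ v
  have hIle : ∀ v ∈ 𝒜, I ≤ Φ v := fun v hv => iInf₂_le v hv
  have hI : I < ∞ := (hIle _ hu₀).trans_lt hfin
  have hex : ∀ j : ℕ, ∃ v ∈ 𝒜, Φ v ≤ I + 2⁻¹ ^ j := by
    intro j
    have h1 : I < I + 2⁻¹ ^ j := ENNReal.lt_add_right hI.ne (by simp)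
    obtain ⟨v, h1⟩ := iInf_lt_iff.1 h1
    obtain ⟨hv, h2⟩ := iInf_lt_iff.1 h1
    exact ⟨v, hv, h2.le⟩
  choose u huA hu using hex
  -- running minima
  let m : ℕ → ℕ → X → ℝ := fun k i => Nat.rec (u k) (fun j w => w ⊓ u (k + j + 1)) i
  have hm0 : ∀ k, m k 0 = u k := fun k => rfl
  have hms : ∀ k i, m k (i + 1) = m k i ⊓ u (k + i + 1) := fun k i => rfl
  have hmA : ∀ k i, m k i ∈ 𝒜 := by
    intro k i
    induction i with
    | zero => exact huA k
    | succ i ih => exact hinf _ ih _ (huA _)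
  have hgeom : ∀ j : ℕ, (2 : ℝ≥0∞)⁻¹ ^ j = 2⁻¹ ^ (j + 1) + 2⁻¹ ^ (j + 1) := by
    intro j
    rw [pow_succ, ← mul_add, ENNReal.inv_two_add_inv_two, mul_one]
  have hmΦ' : ∀ k i, Φ (m k i) + 2⁻¹ ^ (k + i) ≤ I + 2 * 2⁻¹ ^ k := by
    intro k i
    induction i with
    | zero =>
      rw [hm0, add_zero, two_mul, ← add_assoc]
      gcongr
      exact hu k
    | succ i ih =>
      have h1 := hsub _ (hmA k i) _ (huA (k + i + 1))
      rw [← hms] at h1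
      have h2 : I + (Φ (m k (i + 1)) + 2⁻¹ ^ (k + i + 1)) ≤ I + (I + 2 * 2⁻¹ ^ k) := by
        calc I + (Φ (m k (i + 1)) + 2⁻¹ ^ (k + i + 1))
            ≤ Φ (m k i ⊔ u (k + i + 1)) + (Φ (m k (i + 1)) + 2⁻¹ ^ (k + i + 1)) := by
              gcongr
              exact hIle _ (hsup _ (hmA k i) _ (huA _))
          _ = Φ (m k (i + 1)) + Φ (m k i ⊔ u (k + i + 1)) + 2⁻¹ ^ (k + i + 1) := by ring
          _ ≤ Φ (m k i) + Φ (u (k + i + 1)) + 2⁻¹ ^ (k + i + 1) := by gcongr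
          _ ≤ Φ (m k i) + (I + 2⁻¹ ^ (k + i + 1)) + 2⁻¹ ^ (k + i + 1) := by
              gcongr
              exact hu _
          _ = I + (Φ (m k i) + 2⁻¹ ^ (k + i)) := by rw [hgeom (k + i)]; ring
          _ ≤ _ := by gcongr
      exact (ENNReal.add_le_add_iff_left hI.ne).1 h2
  have hmΦ : ∀ k i, Φ (m k i) ≤ I + 2 * 2⁻¹ ^ k := fun k i => le_self_add.trans (hmΦ' k i)
  have hpow : ∀ k : ℕ, (2 : ℝ≥0∞)⁻¹ ^ k ≤ 1 := fun k => pow_le_one₀ (by simp) (by simp)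
  have hb : ∀ v ∈ 𝒜, Φ v ≤ I + 2 → ∫⁻ x, ‖v x‖ₑ ∂μ ≤ (I + 2) / c := by
    intro v hv h
    rw [ENNReal.le_div_iff_mul_le (Or.inl hc) (Or.inl hc'), mul_comm]
    exact (hcoer v hv).trans h
  have hbtop : (I + 2) / c < ∞ :=
    ENNReal.div_lt_top (ENNReal.add_lt_top.2 ⟨hI, by simp⟩).ne hc
  have hle2 : ∀ k : ℕ, I + 2 * 2⁻¹ ^ k ≤ I + 2 := fun k => by
    gcongr
    exact mul_le_of_le_one_right' (hpow k)
  have hlim : ∀ k, ∃ w : X → ℝ, ∀ᵐ x ∂μ, Tendsto (fun i => m k i x) atTop (nhds (w x)) := by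
    intro k
    refine exists_ae_tendsto_of_ae_antitone (fun i => hmeas _ (hmA k i))
      (Eventually.of_forall fun x => antitone_nat_of_succ_le fun i => ?_) hbtop
      fun i => hb _ (hmA k i) ((hmΦ k i).trans (hle2 k))
    rw [hms]
    exact min_le_left _ _
  choose w hw using hlim
  have hwA : ∀ k, w k ∈ 𝒜 := fun k => (hlsc _ _ (hmA k) (hw k)).1
  have hwΦ : ∀ k, Φ (w k) ≤ I + 2 * 2⁻¹ ^ k := fun k =>
    (hlsc _ _ (hmA k) (hw k)).2.trans (liminf_le_of_frequently_le'
      (Frequently.of_forall (hmΦ k)))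
  have hshift : ∀ k i x, m k (i + 1) x ≤ m (k + 1) i x := by
    intro k i x
    induction i with
    | zero => exact min_le_right _ _
    | succ i ih =>
      rw [hms k (i + 1), hms (k + 1) i]
      refine min_le_min ih (le_of_eq ?_)
      congr 1; omega
  have hmono : ∀ᵐ x ∂μ, Monotone fun k => w k x := by
    filter_upwards [ae_all_iff.2 hw] with x hx
    exact monotone_nat_of_le_succ fun k =>
      le_of_tendsto_of_tendsto' ((hx k).comp (tendsto_add_atTop_nat 1)) (hx (k + 1))
        fun i => hshift k i x
  obtain ⟨v, hv⟩ := exists_ae_tendsto_of_ae_monotone (fun k => hmeas _ (hwA k)) hmono hbtop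
    fun k => hb _ (hwA k) ((hwΦ k).trans (hle2 k))
  obtain ⟨hvA, hvΦ⟩ := hlsc _ _ hwA hv
  refine ⟨v, hvA, fun v' hv' => hvΦ.trans (le_trans ?_ (hIle v' hv'))⟩
  have ht : Tendsto (fun k : ℕ => I + 2 * (2 : ℝ≥0∞)⁻¹ ^ k) atTop (nhds (I + 2 * 0)) :=
    tendsto_const_nhds.add (ENNReal.Tendsto.const_mul
      (ENNReal.tendsto_pow_atTop_nhds_zero_of_lt_one (by simp)) (Or.inr (by simp)))
  rw [mul_zero, add_zero] at ht
  exact (liminf_le_liminf (Eventually.of_forall hwΦ)).trans ht.liminf_eq.le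

/-! ### The energy density and the interaction with the exterior datum -/

/-- The energy density at the pair `(x, y)` of a function with increment `t` between `x` and
`y`. -/
def edens {n : ℕ} (s : ℝ) (x y : E n) (t : ℝ) : ℝ :=
  GG n s (t / ‖x - y‖) / ‖x - y‖ ^ ((n : ℝ) - 1 + s)

section edens

variable {n : ℕ} {s : ℝ}

lemma densityDiff_eq (u v : E n → ℝ) (p : E n × E n) :
    densityDiff s u v p = edens s p.1 p.2 (u p.1 - u p.2) - edens s p.1 p.2 (v p.1 - v p.2) :=
  sub_div _ _ _

lemma edens_nonneg (x y : E n) (t : ℝ) : 0 ≤ edens s x y t :=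
  div_nonneg (GG_nonneg _ _ _) (by positivity)

lemma edens_zero (x y : E n) : edens s x y 0 = 0 := by simp [edens, GG_zero]

lemma edens_swap (x y : E n) (t : ℝ) : edens s y x (-t) = edens s x y t := by
  rw [edens, edens, norm_sub_rev, neg_div, GG_neg]

lemma continuous_edens (x y : E n) : Continuous (edens s x y) := by
  unfold edens
  exact ((continuous_GG n s).comp (continuous_id.div_const _)).div_const _

lemma measurable_edens : Measurable fun q : (E n × E n) × ℝ => edens s q.1.1 q.1.2 q.2 := by
  unfold edens
  have := (continuous_GG n s).measurable
  fun_prop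

lemma aemeasurable_edens {α : Type*} [MeasurableSpace α] {μ : Measure α} {f g : α → E n}
    {h : α → ℝ} (hf : AEMeasurable f μ) (hg : AEMeasurable g μ) (hh : AEMeasurable h μ) :
    AEMeasurable (fun a => edens s (f a) (g a) (h a)) μ :=
  measurable_edens.comp_aemeasurable (f := fun a => ((f a, g a), h a)) ((hf.prodMk hg).prodMk hh)

lemma norm_rpow_split {x y : E n} (h : x ≠ y) :
    ‖x - y‖ ^ ((n : ℝ) + s) = ‖x - y‖ * ‖x - y‖ ^ ((n : ℝ) - 1 + s) := by
  have hr : 0 < ‖x - y‖ := norm_pos_iff.2 (sub_ne_zero.2 h)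
  rw [show (n : ℝ) + s = 1 + ((n : ℝ) - 1 + s) by ring, Real.rpow_add hr, Real.rpow_one]

lemma abs_edens_sub_le (hn : 1 ≤ n) (hs : 0 < s) (x y : E n) (t t' : ℝ) :
    |edens s x y t - edens s x y t'| ≤ 2 * |t - t'| * (1 / ‖x - y‖ ^ ((n : ℝ) + s)) := by
  rcases eq_or_ne x y with rfl | h
  · simp only [edens, sub_self, norm_zero, div_zero, GG_zero, zero_div, abs_zero]
    positivity
  have hr : 0 < ‖x - y‖ := norm_pos_iff.2 (sub_ne_zero.2 h)
  have hp : 0 < ‖x - y‖ ^ ((n : ℝ) - 1 + s) := by positivity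
  rw [edens, edens, ← sub_div, abs_div, abs_of_pos hp, norm_rpow_split h, div_le_iff₀ hp]
  refine (abs_GG_sub_le hn hs _ _).trans (le_of_eq ?_)
  rw [← sub_div, abs_div, abs_of_pos hr]
  field_simp

lemma edens_le (hn : 1 ≤ n) (hs : 0 < s) (x y : E n) (t : ℝ) :
    edens s x y t ≤ 2 * |t| * (1 / ‖x - y‖ ^ ((n : ℝ) + s)) := by
  have := abs_edens_sub_le hn hs x y t 0
  rw [edens_zero, sub_zero, sub_zero] at this
  exact (le_abs_self _).trans this

lemma edens_ge (hn : 1 ≤ n) (hs : 0 < s) (x y : E n) (t : ℝ) :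
    G n s 1 * |t| * (1 / ‖x - y‖ ^ ((n : ℝ) + s)) -
      G n s 1 * (1 / ‖x - y‖ ^ ((n : ℝ) - 1 + s)) ≤ edens s x y t := by
  have hn' : (1 : ℝ) ≤ n := by exact_mod_cast hn
  rcases eq_or_ne x y with rfl | h
  · rw [sub_self, norm_zero, Real.zero_rpow (by linarith), Real.zero_rpow (by linarith)]
    simpa using edens_nonneg x x t
  have hr : 0 < ‖x - y‖ := norm_pos_iff.2 (sub_ne_zero.2 h)
  have hp : 0 < ‖x - y‖ ^ ((n : ℝ) - 1 + s) := by positivity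
  rw [edens, norm_rpow_split h, le_div_iff₀ hp]
  refine le_trans (le_of_eq ?_) (GG_ge n s (t / ‖x - y‖))
  rw [abs_div, abs_of_pos hr]
  field_simp

lemma edens_min_add_max_le (x y : E n) (a b c d : ℝ) :
    edens s x y (min a c - min b d) + edens s x y (max a c - max b d) ≤
      edens s x y (a - b) + edens s x y (c - d) := by
  have hr := norm_nonneg (x - y)
  unfold edens
  rw [← add_div, ← add_div]
  refine div_le_div_of_nonneg_right ?_ (by positivity)
  have := map_min_sub_min_add_map_max_sub_max_le (strictConvexOn_GG n s).convexOn
    (a / ‖x - y‖) (b / ‖x - y‖) (c / ‖x - y‖) (d / ‖x - y‖)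
  simpa only [min_div_div_right hr, max_div_div_right hr, ← sub_div] using this

lemma edens_midpoint_le (x y : E n) (a b : ℝ) :
    2 * edens s x y ((a + b) / 2) ≤ edens s x y a + edens s x y b := by
  have h := (strictConvexOn_GG n s).convexOn.2 (mem_univ (a / ‖x - y‖)) (mem_univ (b / ‖x - y‖))
    (by norm_num : (0 : ℝ) ≤ 1 / 2) (by norm_num : (0 : ℝ) ≤ 1 / 2) (by norm_num)
  simp only [smul_eq_mul] at h
  rw [show 1 / 2 * (a / ‖x - y‖) + 1 / 2 * (b / ‖x - y‖) = (a + b) / 2 / ‖x - y‖ by ring] at h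
  unfold edens
  rw [← add_div, mul_div_assoc']
  exact div_le_div_of_nonneg_right (by linarith) (by positivity)

lemma eq_of_edens_midpoint_eq {x y : E n} (hxy : x ≠ y) {a b : ℝ}
    (h : edens s x y a + edens s x y b ≤ 2 * edens s x y ((a + b) / 2)) : a = b := by
  by_contra hab
  have hr : 0 < ‖x - y‖ := norm_pos_iff.2 (sub_ne_zero.2 hxy)
  have hlt := (strictConvexOn_GG n s).2 (mem_univ (a / ‖x - y‖)) (mem_univ (b / ‖x - y‖))
    (fun h => hab ((div_left_inj' hr.ne').1 h))
    (by norm_num : (0 : ℝ) < 1 / 2) (by norm_num : (0 : ℝ) < 1 / 2) (by norm_num)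
  simp only [smul_eq_mul] at hlt
  rw [show 1 / 2 * (a / ‖x - y‖) + 1 / 2 * (b / ‖x - y‖) = (a + b) / 2 / ‖x - y‖ by ring] at hlt
  unfold edens at h
  rw [← add_div, mul_div_assoc', div_le_div_iff_of_pos_right (by positivity)] at h
  linarith

end edens

/-- The interaction of the value `t` at `x` with the exterior datum `φ`, normalized so as to vanish
at the reference value `K`. The integral of the difference converges for every `φ`. -/
def extEnergy {n : ℕ} (s : ℝ) (Ω : Set (E n)) (φ : E n → ℝ) (K : ℝ) (x : E n) (t : ℝ) : ℝ :=
  ∫ y in Ωᶜ, (edens s x y (t - φ y) - edens s x y (K - φ y))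

section extEnergy

variable {n : ℕ} {s : ℝ} {Ω : Set (E n)} {φ : E n → ℝ} {K : ℝ}

lemma integrableOn_kernel (hn : 1 ≤ n) (hs : 0 < s) (hΩ : IsOpen Ω) {x : E n} (hx : x ∈ Ω) :
    IntegrableOn (fun y => 1 / ‖x - y‖ ^ ((n : ℝ) + s)) Ωᶜ := by
  refine ⟨(by fun_prop : Measurable fun y : E n =>
    1 / ‖x - y‖ ^ ((n : ℝ) + s)).aestronglyMeasurable, ?_⟩
  rw [hasFiniteIntegral_iff_ofReal (Filter.Eventually.of_forall fun y => by positivity)]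
  exact extMass_lt_top hn hs hΩ hx

lemma integral_kernel_eq {S : Set (E n)} (x : E n) (p : ℝ) :
    ∫ y in S, 1 / ‖x - y‖ ^ p = (∫⁻ y in S, ENNReal.ofReal (1 / ‖x - y‖ ^ p)).toReal :=
  integral_eq_lintegral_of_nonneg_ae (Filter.Eventually.of_forall fun y => by positivity)
    (by fun_prop : Measurable fun y : E n => 1 / ‖x - y‖ ^ p).aestronglyMeasurable

lemma integrableOn_edens_sub (hn : 1 ≤ n) (hs : 0 < s) (hΩ : IsOpen Ω)
    (hφ : AEMeasurable φ (volume.restrict Ωᶜ)) {x : E n} (hx : x ∈ Ω) (t t' : ℝ) :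
    IntegrableOn (fun y => edens s x y (t - φ y) - edens s x y (t' - φ y)) Ωᶜ := by
  refine ((integrableOn_kernel hn hs hΩ hx).const_mul (2 * |t - t'|)).mono' ?_
    (Filter.Eventually.of_forall fun y => ?_)
  · have h : ∀ t : ℝ, AEMeasurable (fun y => edens s x y (t - φ y)) (volume.restrict Ωᶜ) :=
      fun t => aemeasurable_edens aemeasurable_const aemeasurable_id (hφ.const_sub t)
    exact ((h t).sub (h t')).aestronglyMeasurable
  · have := abs_edens_sub_le hn hs x y (t - φ y) (t' - φ y)
    rwa [sub_sub_sub_cancel_right] at this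

lemma extEnergy_sub (hn : 1 ≤ n) (hs : 0 < s) (hΩ : IsOpen Ω)
    (hφ : AEMeasurable φ (volume.restrict Ωᶜ)) {x : E n} (hx : x ∈ Ω) (t t' : ℝ) :
    extEnergy s Ω φ K x t - extEnergy s Ω φ K x t' =
      ∫ y in Ωᶜ, (edens s x y (t - φ y) - edens s x y (t' - φ y)) := by
  rw [extEnergy, extEnergy, ← integral_sub (integrableOn_edens_sub hn hs hΩ hφ hx _ _)
    (integrableOn_edens_sub hn hs hΩ hφ hx _ _)]
  simp only [sub_sub_sub_cancel_right]

lemma extEnergy_self (x : E n) : extEnergy s Ω φ K x K = 0 := by simp [extEnergy]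

lemma abs_extEnergy_sub_le (hn : 1 ≤ n) (hs : 0 < s) (hΩ : IsOpen Ω)
    (hφ : AEMeasurable φ (volume.restrict Ωᶜ)) {x : E n} (hx : x ∈ Ω) (t t' : ℝ) :
    |extEnergy s Ω φ K x t - extEnergy s Ω φ K x t'| ≤
      2 * |t - t'| * (extMass s Ω x).toReal := by
  rw [extEnergy_sub hn hs hΩ hφ hx, extMass, ← integral_kernel_eq, ← integral_const_mul]
  refine (abs_integral_le_integral_abs).trans (integral_mono
    (integrableOn_edens_sub hn hs hΩ hφ hx _ _).abs
    ((integrableOn_kernel hn hs hΩ hx).const_mul _) fun y => ?_)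
  have := abs_edens_sub_le hn hs x y (t - φ y) (t' - φ y)
  rwa [sub_sub_sub_cancel_right] at this

lemma continuous_extEnergy (hn : 1 ≤ n) (hs : 0 < s) (hΩ : IsOpen Ω)
    (hφ : AEMeasurable φ (volume.restrict Ωᶜ)) {x : E n} (hx : x ∈ Ω) :
    Continuous (extEnergy s Ω φ K x) := by
  refine (LipschitzWith.of_dist_le_mul (K := ⟨2 * (extMass s Ω x).toReal, by positivity⟩)
    fun t t' => ?_).continuous
  rw [Real.dist_eq, Real.dist_eq]
  refine (abs_extEnergy_sub_le hn hs hΩ hφ hx t t').trans (le_of_eq ?_)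
  change _ = 2 * (extMass s Ω x).toReal * |t - t'|
  ring

lemma aemeasurable_extEnergy (hφ : AEMeasurable φ (volume.restrict Ωᶜ)) {v : E n → ℝ}
    (hv : AEMeasurable v (volume.restrict Ω)) :
    AEMeasurable (fun x => extEnergy s Ω φ K x (v x)) (volume.restrict Ω) := by
  have h1 : AEMeasurable (fun p : E n × E n => v p.1)
      ((volume.restrict Ω).prod (volume.restrict Ωᶜ)) := hv.comp_fst
  have h2 : AEMeasurable (fun p : E n × E n => φ p.2)
      ((volume.restrict Ω).prod (volume.restrict Ωᶜ)) := hφ.comp_snd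
  have h3 : AEMeasurable (fun p : E n × E n =>
      edens s p.1 p.2 (v p.1 - φ p.2) - edens s p.1 p.2 (K - φ p.2))
      ((volume.restrict Ω).prod (volume.restrict Ωᶜ)) :=
    (aemeasurable_edens measurable_fst.aemeasurable measurable_snd.aemeasurable (h1.sub h2)).sub
      (aemeasurable_edens measurable_fst.aemeasurable measurable_snd.aemeasurable (h2.const_sub K))
  exact (AEStronglyMeasurable.integral_prod_right' (f := fun p : E n × E n =>
      edens s p.1 p.2 (v p.1 - φ p.2) - edens s p.1 p.2 (K - φ p.2))
    h3.aestronglyMeasurable).aemeasurable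

end extEnergy

/-! ### Coercivity of the interaction with the exterior datum -/

/-- The factor `Υ` that fixes the exterior region where `φ` has to be controlled: the interaction
with points at distance at least `Υ diam Ω` costs at most half of the gain from points at
distance between `2 diam Ω` and `Υ diam Ω`. -/
lemma exists_tail_factor (n : ℕ) {s : ℝ} (hs : 0 < s) :
    ∃ Υ : ℝ, 1 < Υ ∧ (G n s 1 + 2) * Υ ^ (-s) ≤ G n s 1 * 2 ^ (-s) / 2 := by
  have hG := G_one_pos n s
  have h1 : Filter.Tendsto (fun Υ : ℝ => (G n s 1 + 2) * Υ ^ (-s)) Filter.atTop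
      (nhds ((G n s 1 + 2) * 0)) := (tendsto_rpow_neg_atTop hs).const_mul _
  rw [mul_zero] at h1
  have hpos : 0 < G n s 1 * 2 ^ (-s) / 2 := by positivity
  obtain ⟨Υ, h2, h3⟩ := ((h1.eventually (gt_mem_nhds hpos)).and
    (Filter.eventually_gt_atTop 1)).exists
  exact ⟨Υ, h3, h2.le⟩

section near

variable {n : ℕ} {s : ℝ} {Ω : Set (E n)} {δ : ℝ}

lemma measurableSet_nbhd (Ω : Set (E n)) (δ : ℝ) : MeasurableSet (nbhd Ω δ) := by
  have : Continuous (signedDist Ω) :=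
    (Metric.continuous_infDist_pt _).sub (Metric.continuous_infDist_pt _)
  exact measurableSet_lt this.measurable measurable_const

lemma signedDist_of_notMem {x : E n} (hx : x ∉ Ω) : signedDist Ω x = Metric.infDist x Ω := by
  rw [signedDist, Metric.infDist_zero_of_mem (show x ∈ Ωᶜ from hx), sub_zero]

lemma le_norm_sub_of_notMem_nbhd {x y : E n} (hx : x ∈ Ω) (hy : y ∉ Ω) (hy' : y ∉ nbhd Ω δ) :
    δ ≤ ‖x - y‖ := by
  have h1 : δ ≤ signedDist Ω y := not_lt.1 hy'
  rw [signedDist_of_notMem hy] at h1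
  rw [norm_sub_rev, ← dist_eq_norm]
  exact h1.trans (Metric.infDist_le_dist_of_mem hx)

lemma nbhd_diff_subset_ball (hb : Bornology.IsBounded Ω) {x : E n} (hx : x ∈ Ω) :
    nbhd Ω δ \ Ω ⊆ Metric.ball x (δ + Metric.diam Ω) := by
  intro y hy
  have h1 : signedDist Ω y < δ := hy.1
  rw [signedDist_of_notMem hy.2, Metric.infDist_lt_iff ⟨x, hx⟩] at h1
  obtain ⟨x', hx', h2⟩ := h1
  rw [Metric.mem_ball]
  linarith [dist_triangle y x' x, Metric.dist_le_diam_of_mem hb hx' hx]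

lemma diam_pos (hn : 1 ≤ n) (hΩ : IsOpen Ω) (hb : Bornology.IsBounded Ω) (hne : Ω.Nonempty) :
    0 < Metric.diam Ω := by
  have := nontrivial_E hn
  obtain ⟨x, hx⟩ := hne
  refine Metric.diam_pos ?_ hb
  have : (nhdsWithin x {x}ᶜ).NeBot := inferInstance
  obtain ⟨y, hy, hyx⟩ : (Ω ∩ {x}ᶜ).Nonempty := Filter.nonempty_of_mem (f := nhdsWithin x {x}ᶜ)
    (Filter.inter_mem (mem_nhdsWithin_of_mem_nhds (hΩ.mem_nhds hx)) self_mem_nhdsWithin)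
  exact ⟨x, hx, y, hy, fun h => hyx h.symm⟩

end near

/-- Points of the exterior near `Ω` interact with `Ω` more strongly than those far away, even after
the former interaction is multiplied by the small slope `G 1` of the lower bound of the energy
density and the latter by its Lipschitz constant `2`. -/
lemma near_mass_sub_far_mass_ge {n : ℕ} {s : ℝ} (hn : 1 ≤ n) (hs : 0 < s) {Ω : Set (E n)}
    (hΩ : IsOpen Ω) (hb : Bornology.IsBounded Ω) {Υ : ℝ} (hΥ : 1 < Υ)
    (hΥs : (G n s 1 + 2) * Υ ^ (-s) ≤ G n s 1 * 2 ^ (-s) / 2) {x : E n} (hx : x ∈ Ω) :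
    G n s 1 * 2 ^ (-s) / 2 * (kernelMass n s * Metric.diam Ω ^ (-s)) ≤
      G n s 1 * (∫ y in nbhd Ω (Υ * Metric.diam Ω) \ Ω, 1 / ‖x - y‖ ^ ((n : ℝ) + s)) -
        2 * ∫ y in Ωᶜ \ nbhd Ω (Υ * Metric.diam Ω), 1 / ‖x - y‖ ^ ((n : ℝ) + s) := by
  have hG := G_one_pos n s
  have hσ := kernelMass_pos hn hs
  have hD := diam_pos hn hΩ hb ⟨x, hx⟩
  set D := Metric.diam Ω
  set N := nbhd Ω (Υ * D)
  have hfar : ∫ y in Ωᶜ \ N, 1 / ‖x - y‖ ^ ((n : ℝ) + s) ≤ kernelMass n s * (Υ * D) ^ (-s) := by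
    rw [integral_kernel_eq]
    refine ENNReal.toReal_le_of_le_ofReal (by positivity) ?_
    rw [← lintegral_kernel_tail hn hs x (by positivity)]
    exact lintegral_mono_set fun y hy => le_norm_sub_of_notMem_nbhd hx hy.1 hy.2
  have hnear : kernelMass n s * (2 * D) ^ (-s) ≤
      (∫ y in N \ Ω, 1 / ‖x - y‖ ^ ((n : ℝ) + s)) + kernelMass n s * (Υ * D) ^ (-s) := by
    have hfin : ∫⁻ y in N \ Ω, ENNReal.ofReal (1 / ‖x - y‖ ^ ((n : ℝ) + s)) ≠ ∞ :=
      ((lintegral_mono_set fun y hy => hy.2).trans_lt (extMass_lt_top hn hs hΩ hx)).ne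
    have h1 : ENNReal.ofReal (kernelMass n s * (2 * D) ^ (-s)) ≤
        (∫⁻ y in N \ Ω, ENNReal.ofReal (1 / ‖x - y‖ ^ ((n : ℝ) + s))) +
          ENNReal.ofReal (kernelMass n s * (Υ * D) ^ (-s)) := by
      rw [← lintegral_kernel_tail hn hs x (by positivity),
        ← lintegral_kernel_tail hn hs x (by positivity)]
      refine (lintegral_mono_set fun y hy => ?_).trans (lintegral_union_le _ _ _)
      by_cases hyD : Υ * D ≤ ‖x - y‖
      · exact Or.inr hyD
      · have hyΩ : y ∉ Ω := fun hyΩ => by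
          have h2 : 2 * D ≤ ‖x - y‖ := hy
          rw [← dist_eq_norm] at h2
          linarith [Metric.dist_le_diam_of_mem hb hx hyΩ]
        refine Or.inl ⟨?_, hyΩ⟩
        by_contra hyN
        exact hyD (le_norm_sub_of_notMem_nbhd hx hyΩ hyN)
    rw [integral_kernel_eq]
    have h2 := ENNReal.toReal_mono (ENNReal.add_lt_top.2 ⟨hfin.lt_top, ENNReal.ofReal_lt_top⟩).ne h1
    rwa [ENNReal.toReal_add hfin ENNReal.ofReal_ne_top, ENNReal.toReal_ofReal (by positivity),
      ENNReal.toReal_ofReal (by positivity)] at h2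
  rw [Real.mul_rpow (by positivity) hD.le] at hfar
  rw [Real.mul_rpow zero_le_two hD.le, Real.mul_rpow (by positivity) hD.le] at hnear
  have hm : 0 < kernelMass n s * D ^ (-s) := by positivity
  have h3 := mul_le_mul_of_nonneg_right hΥs hm.le
  have h4 := mul_le_mul_of_nonneg_left hnear hG.le
  nlinarith

/-- The function whose negative bounds the interaction with the exterior datum from below, where
`C` bounds the integral of `‖x - y‖^{-(n-1+s)}` over the part of the exterior near `Ω`. -/
def lowerBd {n : ℕ} (s : ℝ) (Ω : Set (E n)) (φ : E n → ℝ) (K Υ C : ℝ) (x : E n) : ℝ :=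
  (G n s 1 + 2) * (tail s φ (nbhd Ω (Υ * Metric.diam Ω) \ Ω) x).toReal +
    2 * K * (extMass s Ω x).toReal + G n s 1 * C

/-- Coercivity: the interaction with the exterior datum grows at least linearly in the value at
`x`, up to a function of `x` controlled by the tail of the datum near `Ω`. -/
lemma extEnergy_add_lowerBd_ge {n : ℕ} {s : ℝ} (hn : 1 ≤ n) (hs : 0 < s) {Ω : Set (E n)}
    (hΩ : IsOpen Ω) (hb : Bornology.IsBounded Ω) {Υ : ℝ} (hΥ : 1 < Υ)
    (hΥs : (G n s 1 + 2) * Υ ^ (-s) ≤ G n s 1 * 2 ^ (-s) / 2) {φ : E n → ℝ}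
    (hφ : AEMeasurable φ (volume.restrict Ωᶜ)) {K : ℝ} (hK : 0 ≤ K) {C : ℝ} (hC0 : 0 ≤ C)
    (hC : ∀ x : E n, ∫⁻ y in Metric.ball x (Υ * Metric.diam Ω + Metric.diam Ω),
      ENNReal.ofReal (1 / ‖x - y‖ ^ ((n : ℝ) - 1 + s)) ≤ ENNReal.ofReal C) {x : E n} (hx : x ∈ Ω)
    (htail : tail s φ (nbhd Ω (Υ * Metric.diam Ω) \ Ω) x < ∞) (t : ℝ) :
    G n s 1 * 2 ^ (-s) / 2 * (kernelMass n s * Metric.diam Ω ^ (-s)) * |t| ≤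
      extEnergy s Ω φ K x t + lowerBd s Ω φ K Υ C x := by
  have hG := G_one_pos n s
  have hmass := near_mass_sub_far_mass_ge hn hs hΩ hb hΥ hΥs hx
  set N := nbhd Ω (Υ * Metric.diam Ω) with hN
  have hNm : MeasurableSet N := measurableSet_nbhd _ _
  have hFm : MeasurableSet (Ωᶜ \ N) := hΩ.measurableSet.compl.diff hNm
  have hsplit : N \ Ω ∪ Ωᶜ \ N = Ωᶜ := by
    ext y; by_cases h : y ∈ N <;> simp [h]
  have hdisj : Disjoint (N \ Ω) (Ωᶜ \ N) :=
    disjoint_left.2 fun y h1 h2 => h2.2 h1.1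
  have hsub1 : N \ Ω ⊆ Ωᶜ := fun y hy => hy.2
  have hsub2 : Ωᶜ \ N ⊆ Ωᶜ := fun y hy => hy.1
  have hf := integrableOn_edens_sub hn hs hΩ hφ hx t K
  let k : E n → ℝ := fun y => 1 / ‖x - y‖ ^ ((n : ℝ) + s)
  let k' : E n → ℝ := fun y => 1 / ‖x - y‖ ^ ((n : ℝ) - 1 + s)
  have hk : IntegrableOn k Ωᶜ := integrableOn_kernel hn hs hΩ hx
  have hk0 : ∀ y, 0 ≤ k y := fun y => by positivity
  have hkm : Measurable k := by fun_prop
  have hkm' : Measurable k' := by fun_prop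
  have hballC : ∫⁻ y in N \ Ω, ENNReal.ofReal (k' y) ≤ ENNReal.ofReal C :=
    (lintegral_mono_set (nbhd_diff_subset_ball hb hx)).trans (hC x)
  have hk' : IntegrableOn k' (N \ Ω) := by
    refine ⟨hkm'.aestronglyMeasurable, ?_⟩
    rw [hasFiniteIntegral_iff_ofReal (Filter.Eventually.of_forall fun y => by positivity)]
    exact hballC.trans_lt ENNReal.ofReal_lt_top
  have hk'C : ∫ y in N \ Ω, k' y ≤ C := by
    rw [integral_kernel_eq]
    exact ENNReal.toReal_le_of_le_ofReal hC0 hballC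
  have hφm : AEMeasurable φ (volume.restrict (N \ Ω)) := hφ.mono_measure
    (Measure.restrict_mono hsub1 le_rfl)
  have hφk : IntegrableOn (fun y => |φ y| * k y) (N \ Ω) := by
    refine ⟨(hφm.abs.mul hkm.aemeasurable).aestronglyMeasurable, ?_⟩
    rw [hasFiniteIntegral_iff_ofReal (Filter.Eventually.of_forall fun y =>
      mul_nonneg (abs_nonneg _) (hk0 y))]
    simpa only [tail, k, mul_one_div] using htail
  have hφT : ∫ y in N \ Ω, |φ y| * k y = (tail s φ (N \ Ω) x).toReal := by
    rw [integral_eq_lintegral_of_nonneg_ae (Filter.Eventually.of_forall fun y =>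
      mul_nonneg (abs_nonneg _) (hk0 y)) hφk.1]
    simp only [tail, k, mul_one_div]
  have hnear : G n s 1 * |t| * (∫ y in N \ Ω, k y) -
      (G n s 1 + 2) * (tail s φ (N \ Ω) x).toReal - 2 * K * (∫ y in N \ Ω, k y) - G n s 1 * C ≤
      ∫ y in N \ Ω, (edens s x y (t - φ y) - edens s x y (K - φ y)) := by
    have i1 : IntegrableOn (fun y => (G n s 1 * |t| - 2 * K) * k y) (N \ Ω) :=
      (hk.mono_set hsub1).const_mul _
    have i2 : IntegrableOn (fun y => (G n s 1 + 2) * (|φ y| * k y)) (N \ Ω) := hφk.const_mul _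
    have i3 : IntegrableOn (fun y => G n s 1 * k' y) (N \ Ω) := hk'.const_mul _
    have i12 : IntegrableOn (fun y => (G n s 1 * |t| - 2 * K) * k y -
        (G n s 1 + 2) * (|φ y| * k y)) (N \ Ω) := i1.sub i2
    have h1 : ∫ y in N \ Ω, ((G n s 1 * |t| - 2 * K) * k y - (G n s 1 + 2) * (|φ y| * k y) -
        G n s 1 * k' y) ≤ ∫ y in N \ Ω, (edens s x y (t - φ y) - edens s x y (K - φ y)) := by
      refine integral_mono (i12.sub i3) (hf.mono_set hsub1) fun y => ?_
      have h2 := edens_ge hn hs x y (t - φ y)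
      have h3 := edens_le hn hs x y (K - φ y)
      have h4 : |t| - |φ y| ≤ |t - φ y| := abs_sub_abs_le_abs_sub _ _
      have h5 : |K - φ y| ≤ K + |φ y| := by
        have := abs_sub K (φ y)
        rwa [abs_of_nonneg hK] at this
      have h6 : G n s 1 * (|t| - |φ y|) * k y ≤ G n s 1 * |t - φ y| * k y := by
        gcongr
      have h7 : 2 * |K - φ y| * k y ≤ 2 * (K + |φ y|) * k y := by
        gcongr
      simp only [k, k'] at h6 h7 ⊢
      nlinarith
    rw [integral_sub i12 i3, integral_sub i1 i2, integral_const_mul, integral_const_mul,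
      integral_const_mul, hφT] at h1
    have h2 : G n s 1 * (∫ y in N \ Ω, k' y) ≤ G n s 1 * C := by gcongr
    linarith
  have hfar : -(2 * |t| + 2 * K) * (∫ y in Ωᶜ \ N, k y) ≤
      ∫ y in Ωᶜ \ N, (edens s x y (t - φ y) - edens s x y (K - φ y)) := by
    rw [← integral_const_mul]
    refine integral_mono ((hk.mono_set hsub2).const_mul _) (hf.mono_set hsub2) fun y => ?_
    have h1 := (abs_le.1 (abs_edens_sub_le hn hs x y (t - φ y) (K - φ y))).1
    rw [sub_sub_sub_cancel_right] at h1
    have h2 : |t - K| ≤ |t| + K := by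
      have := abs_sub t K
      rwa [abs_of_nonneg hK] at this
    have h3 : 2 * |t - K| * k y ≤ 2 * (|t| + K) * k y := by gcongr
    simp only [k] at h3 ⊢
    nlinarith
  have hE : extEnergy s Ω φ K x t =
      (∫ y in N \ Ω, (edens s x y (t - φ y) - edens s x y (K - φ y))) +
        ∫ y in Ωᶜ \ N, (edens s x y (t - φ y) - edens s x y (K - φ y)) := by
    rw [extEnergy, ← setIntegral_union hdisj hFm (hf.mono_set hsub1) (hf.mono_set hsub2), hsplit]
  have hm : (extMass s Ω x).toReal = (∫ y in N \ Ω, k y) + ∫ y in Ωᶜ \ N, k y := by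
    rw [extMass, ← integral_kernel_eq, ← setIntegral_union hdisj hFm (hk.mono_set hsub1)
      (hk.mono_set hsub2), hsplit]
  have h8 := mul_le_mul_of_nonneg_right hmass (abs_nonneg t)
  rw [hE, lowerBd, ← hN, hm]
  simp only [k] at hnear hfar ⊢
  nlinarith

/-! ### The renormalized energy -/

/-- The energy of `v` on `Q(Ω)`, up to an additive constant: the interaction of `Ω` with itself, and
twice that of `Ω` with its complement, where the latter is normalized by subtracting the interaction
of the constant `K` and then made nonnegative by adding the function `b`. Only the values of `v` in
`Ω` enter. -/
def energy {n : ℕ} (s : ℝ) (Ω : Set (E n)) (φ : E n → ℝ) (K : ℝ) (b : E n → ℝ) (v : E n → ℝ) :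
    ℝ≥0∞ :=
  (∫⁻ p, ENNReal.ofReal (edens s p.1 p.2 (v p.1 - v p.2))
      ∂((volume.restrict Ω).prod (volume.restrict Ω))) +
    2 * ∫⁻ x in Ω, ENNReal.ofReal (extEnergy s Ω φ K x (v x) + b x)

section energy

variable {n : ℕ} {s : ℝ} {Ω : Set (E n)} {φ : E n → ℝ} {K : ℝ} {b : E n → ℝ}

lemma aemeasurable_edens_sub {v : E n → ℝ} {μ ν : Measure (E n)} [SFinite μ] [SFinite ν]
    (hv : AEMeasurable v μ) (hv' : AEMeasurable v ν) :
    AEMeasurable (fun p : E n × E n => edens s p.1 p.2 (v p.1 - v p.2)) (μ.prod ν) :=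
  aemeasurable_edens measurable_fst.aemeasurable measurable_snd.aemeasurable
    (hv.comp_fst.sub hv'.comp_snd)

lemma energy_congr {u v : E n → ℝ} (h : u =ᵐ[volume.restrict Ω] v) :
    energy s Ω φ K b u = energy s Ω φ K b v := by
  unfold energy
  congr 1
  · refine lintegral_congr_ae ?_
    filter_upwards [Measure.quasiMeasurePreserving_fst.ae h,
      Measure.quasiMeasurePreserving_snd.ae h] with p h1 h2
    rw [h1, h2]
  · congr 1
    refine lintegral_congr_ae ?_
    filter_upwards [h] with x hx
    rw [hx]

lemma energy_inf_add_energy_sup_le (hφ : AEMeasurable φ (volume.restrict Ωᶜ))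
    (hb : AEMeasurable b (volume.restrict Ω)) {u v : E n → ℝ}
    (hu : AEMeasurable u (volume.restrict Ω)) (hv : AEMeasurable v (volume.restrict Ω)) :
    energy s Ω φ K b (u ⊓ v) + energy s Ω φ K b (u ⊔ v) ≤
      energy s Ω φ K b u + energy s Ω φ K b v := by
  have hm : ∀ w : E n → ℝ, AEMeasurable w (volume.restrict Ω) →
      AEMeasurable (fun p : E n × E n => ENNReal.ofReal (edens s p.1 p.2 (w p.1 - w p.2)))
        ((volume.restrict Ω).prod (volume.restrict Ω)) := fun w hw =>
    (aemeasurable_edens_sub hw hw).ennreal_ofReal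
  have hm' : ∀ w : E n → ℝ, AEMeasurable w (volume.restrict Ω) →
      AEMeasurable (fun x => ENNReal.ofReal (extEnergy s Ω φ K x (w x) + b x))
        (volume.restrict Ω) := fun w hw =>
    ((aemeasurable_extEnergy hφ hw).add hb).ennreal_ofReal
  have hint : ∀ p : E n × E n,
      ENNReal.ofReal (edens s p.1 p.2 ((u ⊓ v) p.1 - (u ⊓ v) p.2)) +
        ENNReal.ofReal (edens s p.1 p.2 ((u ⊔ v) p.1 - (u ⊔ v) p.2)) ≤
      ENNReal.ofReal (edens s p.1 p.2 (u p.1 - u p.2)) +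
        ENNReal.ofReal (edens s p.1 p.2 (v p.1 - v p.2)) := by
    intro p
    rw [← ENNReal.ofReal_add (edens_nonneg _ _ _) (edens_nonneg _ _ _),
      ← ENNReal.ofReal_add (edens_nonneg _ _ _) (edens_nonneg _ _ _)]
    exact ENNReal.ofReal_le_ofReal (edens_min_add_max_le _ _ _ _ _ _)
  have hext : ∀ x : E n,
      ENNReal.ofReal (extEnergy s Ω φ K x ((u ⊓ v) x) + b x) +
        ENNReal.ofReal (extEnergy s Ω φ K x ((u ⊔ v) x) + b x) =
      ENNReal.ofReal (extEnergy s Ω φ K x (u x) + b x) +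
        ENNReal.ofReal (extEnergy s Ω φ K x (v x) + b x) := by
    intro x
    rcases le_total (u x) (v x) with h | h
    · rw [Pi.inf_apply, Pi.sup_apply, inf_of_le_left h, sup_of_le_right h]
    · rw [Pi.inf_apply, Pi.sup_apply, inf_of_le_right h, sup_of_le_left h, add_comm]
  unfold energy
  rw [add_add_add_comm, ← mul_add, ← lintegral_add_left' (hm _ (hu.inf hv)),
    ← lintegral_add_left' (hm' _ (hu.inf hv)), lintegral_congr hext,
    lintegral_add_left' (hm' _ hu), mul_add]
  refine (add_le_add (lintegral_mono hint) le_rfl).trans (le_of_eq ?_)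
  rw [lintegral_add_left' (hm _ hu), add_add_add_comm]

open Filter in
lemma energy_le_liminf (hn : 1 ≤ n) (hs : 0 < s) (hΩ : IsOpen Ω)
    (hφ : AEMeasurable φ (volume.restrict Ωᶜ)) (hb : AEMeasurable b (volume.restrict Ω))
    {v : ℕ → E n → ℝ} {w : E n → ℝ} (hv : ∀ k, AEMeasurable (v k) (volume.restrict Ω))
    (hlim : ∀ᵐ x ∂(volume.restrict Ω), Tendsto (fun k => v k x) atTop (nhds (w x))) :
    energy s Ω φ K b w ≤ liminf (fun k => energy s Ω φ K b (v k)) atTop := by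
  have h1 : ∫⁻ p, ENNReal.ofReal (edens s p.1 p.2 (w p.1 - w p.2))
      ∂((volume.restrict Ω).prod (volume.restrict Ω)) ≤
      liminf (fun k => ∫⁻ p, ENNReal.ofReal (edens s p.1 p.2 (v k p.1 - v k p.2))
        ∂((volume.restrict Ω).prod (volume.restrict Ω))) atTop := by
    refine le_trans (lintegral_mono_ae ?_) (lintegral_liminf_le' fun k =>
      (aemeasurable_edens_sub (hv k) (hv k)).ennreal_ofReal)
    filter_upwards [Measure.quasiMeasurePreserving_fst.ae hlim,
      Measure.quasiMeasurePreserving_snd.ae hlim] with p h1 h2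
    refine (Tendsto.liminf_eq ?_).ge
    exact (ENNReal.continuous_ofReal.tendsto _).comp
      (((continuous_edens p.1 p.2).tendsto _).comp (h1.sub h2))
  have h2 : ∫⁻ x in Ω, ENNReal.ofReal (extEnergy s Ω φ K x (w x) + b x) ≤
      liminf (fun k => ∫⁻ x in Ω, ENNReal.ofReal (extEnergy s Ω φ K x (v k x) + b x)) atTop := by
    refine le_trans (lintegral_mono_ae ?_) (lintegral_liminf_le' fun k =>
      ((aemeasurable_extEnergy hφ (hv k)).add hb).ennreal_ofReal)
    filter_upwards [hlim, ae_restrict_mem hΩ.measurableSet] with x h1 hx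
    refine (Tendsto.liminf_eq ?_).ge
    exact (ENNReal.continuous_ofReal.tendsto _).comp
      ((((continuous_extEnergy hn hs hΩ hφ hx).tendsto _).comp h1).add_const _)
  have h3 : 2 * ∫⁻ x in Ω, ENNReal.ofReal (extEnergy s Ω φ K x (w x) + b x) ≤
      liminf (fun k => 2 * ∫⁻ x in Ω, ENNReal.ofReal (extEnergy s Ω φ K x (v k x) + b x))
        atTop := by
    rw [ENNReal.liminf_const_mul_of_ne_top (by simp)]
    gcongr
  refine (add_le_add h1 h3).trans ?_
  simp only [liminf_eq_iSup_iInf_of_nat]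
  rw [ENNReal.iSup_add_iSup_of_monotone]
  · refine iSup_mono fun k => le_iInf₂ fun i hi => add_le_add ?_ ?_
    · exact iInf₂_le (f := fun i (_ : i ≥ k) => ∫⁻ p, ENNReal.ofReal
        (edens s p.1 p.2 (v i p.1 - v i p.2)) ∂((volume.restrict Ω).prod (volume.restrict Ω))) i hi
    · exact iInf₂_le (f := fun i (_ : i ≥ k) => 2 * ∫⁻ x in Ω,
        ENNReal.ofReal (extEnergy s Ω φ K x (v i x) + b x)) i hi
  · exact fun i j hij => biInf_mono fun k hk => le_trans hij hk
  · exact fun i j hij => biInf_mono fun k hk => le_trans hij hk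

lemma lintegral_enorm_le_energy {c : ℝ} (hc : 0 ≤ c)
    (hb : ∀ᵐ x ∂(volume.restrict Ω), ∀ t, c * |t| ≤ extEnergy s Ω φ K x t + b x) (v : E n → ℝ) :
    ENNReal.ofReal (2 * c) * ∫⁻ x in Ω, ‖v x‖ₑ ≤ energy s Ω φ K b v := by
  rw [ENNReal.ofReal_mul zero_le_two, ENNReal.ofReal_ofNat, mul_assoc,
    ← lintegral_const_mul' _ _ ENNReal.ofReal_ne_top]
  refine le_trans ?_ le_add_self
  refine mul_le_mul' le_rfl (lintegral_mono_ae ?_)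
  filter_upwards [hb] with x hx
  rw [Real.enorm_eq_ofReal_abs, ← ENNReal.ofReal_mul hc]
  exact ENNReal.ofReal_le_ofReal (hx _)

lemma gagliardo_eq_lintegral_prod {v : E n → ℝ} (hv : AEMeasurable v (volume.restrict Ω)) :
    gagliardo s Ω v = ∫⁻ p, ENNReal.ofReal (|v p.1 - v p.2| * (1 / ‖p.1 - p.2‖ ^ ((n : ℝ) + s)))
      ∂((volume.restrict Ω).prod (volume.restrict Ω)) := by
  rw [lintegral_prod]
  · simp only [gagliardo, mul_one_div]
  · exact ((hv.comp_fst.sub hv.comp_snd).abs.mul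
      (by fun_prop : Measurable fun p : E n × E n =>
        1 / ‖p.1 - p.2‖ ^ ((n : ℝ) + s)).aemeasurable).ennreal_ofReal

lemma gagliardo_le_energy (hn : 1 ≤ n) (hs : 0 < s) {v : E n → ℝ}
    (hv : AEMeasurable v (volume.restrict Ω)) :
    ENNReal.ofReal (G n s 1) * gagliardo s Ω v ≤ energy s Ω φ K b v +
      ENNReal.ofReal (G n s 1) * ∫⁻ x in Ω, ∫⁻ y in Ω,
        ENNReal.ofReal (1 / ‖x - y‖ ^ ((n : ℝ) - 1 + s)) := by
  have hG := G_one_pos n s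
  have hm : Measurable fun p : E n × E n =>
      ENNReal.ofReal (1 / ‖p.1 - p.2‖ ^ ((n : ℝ) - 1 + s)) := by fun_prop
  rw [gagliardo_eq_lintegral_prod hv, ← lintegral_prod (fun p : E n × E n =>
      ENNReal.ofReal (1 / ‖p.1 - p.2‖ ^ ((n : ℝ) - 1 + s))) hm.aemeasurable,
    ← lintegral_const_mul' _ _ ENNReal.ofReal_ne_top,
    ← lintegral_const_mul' _ _ ENNReal.ofReal_ne_top]
  refine le_trans ?_ (add_le_add (le_self_add : _ ≤ energy s Ω φ K b v) le_rfl)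
  rw [← lintegral_add_left' (aemeasurable_edens_sub hv hv).ennreal_ofReal]
  refine lintegral_mono fun p => ?_
  rw [← ENNReal.ofReal_mul hG.le, ← ENNReal.ofReal_mul hG.le,
    ← ENNReal.ofReal_add (edens_nonneg _ _ _) (by positivity)]
  refine ENNReal.ofReal_le_ofReal ?_
  have := edens_ge hn hs p.1 p.2 (v p.1 - v p.2)
  rw [mul_assoc] at this
  linarith

lemma energy_const (c : ℝ) : energy s Ω φ c b (fun _ => c) =
    2 * ∫⁻ x in Ω, ENNReal.ofReal (b x) := by
  simp [energy, edens_zero, extEnergy_self]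

lemma integrable_edens (hn : 1 ≤ n) (hs : 0 < s) {v : E n → ℝ} (hv : v ∈ W s Ω) :
    Integrable (fun p : E n × E n => edens s p.1 p.2 (v p.1 - v p.2))
      ((volume.restrict Ω).prod (volume.restrict Ω)) := by
  have hvm := hv.1.1.aemeasurable
  refine ⟨(aemeasurable_edens_sub hvm hvm).aestronglyMeasurable, ?_⟩
  rw [hasFiniteIntegral_iff_ofReal (Filter.Eventually.of_forall fun p => edens_nonneg _ _ _)]
  calc _ ≤ ∫⁻ p, ENNReal.ofReal 2 *
        ENNReal.ofReal (|v p.1 - v p.2| * (1 / ‖p.1 - p.2‖ ^ ((n : ℝ) + s)))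
        ∂((volume.restrict Ω).prod (volume.restrict Ω)) := by
        refine lintegral_mono fun p => ?_
        rw [← ENNReal.ofReal_mul zero_le_two, ← mul_assoc]
        exact ENNReal.ofReal_le_ofReal (edens_le hn hs _ _ _)
    _ = ENNReal.ofReal 2 * gagliardo s Ω v := by
        rw [lintegral_const_mul' _ _ ENNReal.ofReal_ne_top, gagliardo_eq_lintegral_prod hvm]
    _ < ∞ := ENNReal.mul_lt_top ENNReal.ofReal_lt_top hv.2

/-- The `L¹` distance of `u` and `v` weighted by the interaction with the exterior is finite. -/
lemma integrable_sub_mul_extMass (hn : 1 ≤ n) (hs : 0 < s) (hΩ : IsOpen Ω) {u v : E n → ℝ}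
    (hu : AEMeasurable u (volume.restrict Ω)) (hv : AEMeasurable v (volume.restrict Ω))
    (hu' : ∫⁻ x in Ω, ENNReal.ofReal |u x| * extMass s Ω x < ∞)
    (hv' : ∫⁻ x in Ω, ENNReal.ofReal |v x| * extMass s Ω x < ∞) :
    Integrable (fun x => |u x - v x| * (extMass s Ω x).toReal) (volume.restrict Ω) := by
  refine ⟨((hu.sub hv).abs.mul
    (measurable_extMass s Ω).ennreal_toReal.aemeasurable).aestronglyMeasurable, ?_⟩
  rw [hasFiniteIntegral_iff_ofReal (Filter.Eventually.of_forall fun p => by positivity)]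
  calc _ ≤ ∫⁻ x in Ω, (ENNReal.ofReal |u x| * extMass s Ω x +
          ENNReal.ofReal |v x| * extMass s Ω x) := by
        refine setLIntegral_mono' hΩ.measurableSet fun x hx => ?_
        rw [ENNReal.ofReal_mul (abs_nonneg _),
          ENNReal.ofReal_toReal (extMass_lt_top hn hs hΩ hx).ne, ← add_mul,
          ← ENNReal.ofReal_add (abs_nonneg _) (abs_nonneg _)]
        gcongr
        exact abs_sub _ _
    _ = _ := lintegral_add_left'
        (hu.abs.ennreal_ofReal.mul (measurable_extMass s Ω).aemeasurable) _
    _ < ∞ := ENNReal.add_lt_top.2 ⟨hu', hv'⟩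

lemma integrable_extEnergy (hn : 1 ≤ n) (hs : 0 < s) (hΩ : IsOpen Ω)
    (hφ : AEMeasurable φ (volume.restrict Ωᶜ)) (hP : ∫⁻ x in Ω, extMass s Ω x < ∞) {v : E n → ℝ}
    (hv : AEMeasurable v (volume.restrict Ω))
    (hv' : ∫⁻ x in Ω, ENNReal.ofReal |v x| * extMass s Ω x < ∞) :
    Integrable (fun x => extEnergy s Ω φ K x (v x)) (volume.restrict Ω) := by
  have hK : ∫⁻ x in Ω, ENNReal.ofReal |K| * extMass s Ω x < ∞ := by
    rw [lintegral_const_mul' _ _ ENNReal.ofReal_ne_top]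
    exact ENNReal.mul_lt_top ENNReal.ofReal_lt_top hP
  refine ((integrable_sub_mul_extMass hn hs hΩ hv (aemeasurable_const (b := K)) hv' hK).const_mul
    2).mono' (aemeasurable_extEnergy hφ hv).aestronglyMeasurable ?_
  filter_upwards [ae_restrict_mem hΩ.measurableSet] with x hx
  have := abs_extEnergy_sub_le (K := K) hn hs hΩ hφ hx (v x) K
  rw [extEnergy_self, sub_zero] at this
  rwa [Real.norm_eq_abs, ← mul_assoc]

lemma densityDiff_swap (u v : E n → ℝ) (p : E n × E n) :
    densityDiff s u v p.swap = densityDiff s u v p := by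
  rw [densityDiff_eq, densityDiff_eq, Prod.fst_swap, Prod.snd_swap, ← edens_swap, neg_sub,
    ← edens_swap p.2 p.1, neg_sub]

lemma Q_eq (Ω : Set (E n)) : Q Ω = (Ω ×ˢ Ω ∪ Ω ×ˢ Ωᶜ) ∪ Ωᶜ ×ˢ Ω := by
  ext p
  simp only [Q, mem_compl_iff, mem_prod, mem_union]
  tauto

lemma integrable_densityDiff_exterior (hn : 1 ≤ n) (hs : 0 < s) (hΩ : IsOpen Ω)
    (hφ : AEMeasurable φ (volume.restrict Ωᶜ)) {u v : E n → ℝ}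
    (hu : AEMeasurable u (volume.restrict Ω)) (hv : AEMeasurable v (volume.restrict Ω))
    (hu' : ∫⁻ x in Ω, ENNReal.ofReal |u x| * extMass s Ω x < ∞)
    (hv' : ∫⁻ x in Ω, ENNReal.ofReal |v x| * extMass s Ω x < ∞)
    (hue : ∀ x ∈ Ωᶜ, u x = φ x) (hve : ∀ x ∈ Ωᶜ, v x = φ x) :
    Integrable (densityDiff s u v) ((volume.restrict Ω).prod (volume.restrict Ωᶜ)) := by
  have hmem : ∀ᵐ x ∂(volume.restrict Ωᶜ), x ∈ Ωᶜ := ae_restrict_mem hΩ.measurableSet.compl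
  have huc : AEMeasurable u (volume.restrict Ωᶜ) :=
    hφ.congr (hmem.mono fun x hx => (hue x hx).symm)
  have hvc : AEMeasurable v (volume.restrict Ωᶜ) :=
    hφ.congr (hmem.mono fun x hx => (hve x hx).symm)
  have hm : AEMeasurable (densityDiff s u v)
      ((volume.restrict Ω).prod (volume.restrict Ωᶜ)) := by
    rw [funext (densityDiff_eq (s := s) u v)]
    exact (aemeasurable_edens_sub hu huc).sub (aemeasurable_edens_sub hv hvc)
  refine ⟨hm.aestronglyMeasurable, ?_⟩
  have h1 := (integrable_sub_mul_extMass hn hs hΩ hu hv hu' hv').2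
  rw [hasFiniteIntegral_iff_ofReal (Filter.Eventually.of_forall fun p => by positivity)] at h1
  rw [hasFiniteIntegral_iff_enorm]
  calc ∫⁻ p, ‖densityDiff s u v p‖ₑ ∂((volume.restrict Ω).prod (volume.restrict Ωᶜ))
      = ∫⁻ x in Ω, ∫⁻ y in Ωᶜ, ‖densityDiff s u v (x, y)‖ₑ := lintegral_prod _ hm.enorm
    _ ≤ ∫⁻ x in Ω, ENNReal.ofReal 2 *
          ENNReal.ofReal (|u x - v x| * (extMass s Ω x).toReal) := by
        refine setLIntegral_mono' hΩ.measurableSet fun x hx => ?_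
        rw [ENNReal.ofReal_mul (abs_nonneg _),
          ENNReal.ofReal_toReal (extMass_lt_top hn hs hΩ hx).ne, ← mul_assoc,
          ← ENNReal.ofReal_mul zero_le_two, extMass,
          ← lintegral_const_mul' _ _ ENNReal.ofReal_ne_top]
        refine setLIntegral_mono' hΩ.measurableSet.compl fun y hy => ?_
        rw [← ENNReal.ofReal_mul (by positivity), Real.enorm_eq_ofReal_abs, densityDiff_eq,
          hue y hy, hve y hy]
        refine ENNReal.ofReal_le_ofReal ?_
        have := abs_edens_sub_le hn hs x y (u x - φ y) (v x - φ y)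
        rwa [sub_sub_sub_cancel_right] at this
    _ < ∞ := by
        rw [lintegral_const_mul' _ _ ENNReal.ofReal_ne_top]
        exact ENNReal.mul_lt_top ENNReal.ofReal_lt_top h1

/-- The difference of the renormalized energies is the integral that defines the obstacle
problem. -/
lemma integral_densityDiff_eq (hn : 1 ≤ n) (hs : 0 < s) (hΩ : IsOpen Ω)
    (hφ : AEMeasurable φ (volume.restrict Ωᶜ)) (hP : ∫⁻ x in Ω, extMass s Ω x < ∞)
    (hbi : Integrable b (volume.restrict Ω))
    (hb : ∀ᵐ x ∂(volume.restrict Ω), ∀ t, 0 ≤ extEnergy s Ω φ K x t + b x) {u v : E n → ℝ}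
    (hu : u ∈ W s Ω) (hv : v ∈ W s Ω)
    (hu' : ∫⁻ x in Ω, ENNReal.ofReal |u x| * extMass s Ω x < ∞)
    (hv' : ∫⁻ x in Ω, ENNReal.ofReal |v x| * extMass s Ω x < ∞)
    (hue : ∀ x ∈ Ωᶜ, u x = φ x) (hve : ∀ x ∈ Ωᶜ, v x = φ x) :
    energy s Ω φ K b u < ∞ ∧ energy s Ω φ K b v < ∞ ∧ IntegrableOn (densityDiff s u v) (Q Ω) ∧
      ∫ p in Q Ω, densityDiff s u v p =
        (energy s Ω φ K b u).toReal - (energy s Ω φ K b v).toReal := by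
  have hum := hu.1.1.aemeasurable
  have hvm := hv.1.1.aemeasurable
  have hΩm := hΩ.measurableSet
  have hen : ∀ w ∈ W s Ω, ∫⁻ x in Ω, ENNReal.ofReal |w x| * extMass s Ω x < ∞ →
      energy s Ω φ K b w < ∞ ∧ (energy s Ω φ K b w).toReal =
        (∫ p, edens s p.1 p.2 (w p.1 - w p.2) ∂((volume.restrict Ω).prod (volume.restrict Ω))) +
        2 * ((∫ x in Ω, extEnergy s Ω φ K x (w x)) + ∫ x in Ω, b x) := by
    intro w hw hw'
    have h1 := integrable_edens hn hs hw
    have h2 := integrable_extEnergy (K := K) hn hs hΩ hφ hP hw.1.1.aemeasurable hw'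
    have h23 : Integrable (fun x => extEnergy s Ω φ K x (w x) + b x) (volume.restrict Ω) :=
      h2.add hbi
    have h3 : energy s Ω φ K b w = ENNReal.ofReal
        ((∫ p, edens s p.1 p.2 (w p.1 - w p.2) ∂((volume.restrict Ω).prod (volume.restrict Ω))) +
        2 * ((∫ x in Ω, extEnergy s Ω φ K x (w x)) + ∫ x in Ω, b x)) := by
      have h4 : 0 ≤ ∫ x in Ω, (extEnergy s Ω φ K x (w x) + b x) :=
        integral_nonneg_of_ae (hb.mono fun x hx => hx _)
      rw [energy, ← ofReal_integral_eq_lintegral_ofReal h1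
          (Filter.Eventually.of_forall fun p => edens_nonneg _ _ _),
        ← ofReal_integral_eq_lintegral_ofReal h23 (hb.mono fun x hx => hx _),
        ← integral_add h2 hbi, ENNReal.ofReal_add
          (integral_nonneg fun p => edens_nonneg _ _ _) (by positivity),
        ENNReal.ofReal_mul zero_le_two, ENNReal.ofReal_ofNat]
    have h5 : 0 ≤ ∫ x in Ω, (extEnergy s Ω φ K x (w x) + b x) :=
      integral_nonneg_of_ae (hb.mono fun x hx => hx _)
    refine ⟨by rw [h3]; exact ENNReal.ofReal_lt_top, ?_⟩
    rw [h3, ENNReal.toReal_ofReal]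
    rw [← integral_add h2 hbi]
    exact add_nonneg (integral_nonneg fun p => edens_nonneg _ _ _) (by positivity)
  have hext := integrable_densityDiff_exterior hn hs hΩ hφ hum hvm hu' hv' hue hve
  have hint : Integrable (densityDiff s u v) ((volume.restrict Ω).prod (volume.restrict Ω)) := by
    rw [funext (densityDiff_eq (s := s) u v)]
    exact (integrable_edens hn hs hu).sub (integrable_edens hn hs hv)
  rw [Measure.prod_restrict] at hint
  have hext' : IntegrableOn (densityDiff s u v) (Ω ×ˢ Ωᶜ) (volume.prod volume) := by
    rw [IntegrableOn, ← Measure.prod_restrict]; exact hext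
  have hsw : IntegrableOn (densityDiff s u v) (Ωᶜ ×ˢ Ω) (volume.prod volume) := by
    refine hext'.swap.congr_fun (fun p _ => densityDiff_swap u v p) (hΩm.compl.prod hΩm)
  refine ⟨(hen u hu hu').1, (hen v hv hv').1, ?_, ?_⟩
  · rw [Q_eq, Measure.volume_eq_prod]
    exact (IntegrableOn.union hint hext').union hsw
  · rw [(hen u hu hu').2, (hen v hv hv').2, Q_eq, Measure.volume_eq_prod,
      setIntegral_union _ (hΩm.compl.prod hΩm) (IntegrableOn.union hint hext') hsw,
      setIntegral_union _ (hΩm.prod hΩm.compl) hint hext']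
    · have h1 : ∫ p in Ω ×ˢ Ω, densityDiff s u v p ∂(volume.prod volume) =
          (∫ p, edens s p.1 p.2 (u p.1 - u p.2)
            ∂((volume.restrict Ω).prod (volume.restrict Ω))) -
          ∫ p, edens s p.1 p.2 (v p.1 - v p.2)
            ∂((volume.restrict Ω).prod (volume.restrict Ω)) := by
        rw [← integral_sub (integrable_edens hn hs hu) (integrable_edens hn hs hv),
          Measure.prod_restrict]
        simp only [densityDiff_eq]
      have h2 : ∫ p in Ω ×ˢ Ωᶜ, densityDiff s u v p ∂(volume.prod volume) =
          (∫ x in Ω, extEnergy s Ω φ K x (u x)) - ∫ x in Ω, extEnergy s Ω φ K x (v x) := by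
        rw [setIntegral_prod _ hext',
          ← integral_sub (integrable_extEnergy hn hs hΩ hφ hP hum hu')
            (integrable_extEnergy hn hs hΩ hφ hP hvm hv')]
        refine setIntegral_congr_fun hΩm fun x hx => ?_
        rw [extEnergy_sub hn hs hΩ hφ hx]
        refine setIntegral_congr_fun hΩm.compl fun y hy => ?_
        rw [densityDiff_eq, hue y hy, hve y hy]
      have h3 : ∫ p in Ωᶜ ×ˢ Ω, densityDiff s u v p ∂(volume.prod volume) =
          ∫ p in Ω ×ˢ Ωᶜ, densityDiff s u v p ∂(volume.prod volume) := by
        rw [← setIntegral_prod_swap]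
        simp only [densityDiff_swap]
      rw [h3, h1, h2]
      ring
    · exact disjoint_left.2 fun p h1 h2 => h2.2 h1.2
    · refine disjoint_left.2 fun p h1 h2 => ?_
      rcases h1 with h1 | h1
      · exact h2.1 h1.1
      · exact h2.1 h1.1

end energy

/-! ### Existence, uniqueness and the estimate -/

section

variable {n : ℕ} {s : ℝ} {Ω : Set (E n)} {φ : E n → ℝ} {K : ℝ} {b : E n → ℝ}

lemma le_ofReal_inv_mul {c : ℝ} (hc : 0 < c) {x e : ℝ≥0∞} (h : ENNReal.ofReal c * x ≤ e) :
    x ≤ ENNReal.ofReal c⁻¹ * e := by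
  calc x = ENNReal.ofReal c⁻¹ * (ENNReal.ofReal c * x) := by
        rw [← mul_assoc, ← ENNReal.ofReal_mul (by positivity), inv_mul_cancel₀ hc.ne',
          ENNReal.ofReal_one, one_mul]
    _ ≤ _ := by gcongr

lemma wNorm_le_energy (hn : 1 ≤ n) (hs : 0 < s) {c : ℝ} (hc : 0 < c)
    (hb : ∀ᵐ x ∂(volume.restrict Ω), ∀ t, c * |t| ≤ extEnergy s Ω φ K x t + b x) {v : E n → ℝ}
    (hv : AEMeasurable v (volume.restrict Ω)) :
    wNorm s Ω v ≤ ENNReal.ofReal ((2 * c)⁻¹ + (G n s 1)⁻¹) * energy s Ω φ K b v +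
      ∫⁻ x in Ω, ∫⁻ y in Ω, ENNReal.ofReal (1 / ‖x - y‖ ^ ((n : ℝ) - 1 + s)) := by
  have hG := G_one_pos n s
  have h1 := le_ofReal_inv_mul (by positivity) (lintegral_enorm_le_energy hc.le hb v)
  have h2 := le_ofReal_inv_mul hG (gagliardo_le_energy (φ := φ) (K := K) (b := b) hn hs hv)
  rw [mul_add, ← mul_assoc _ (ENNReal.ofReal (G n s 1)), ← ENNReal.ofReal_mul (by positivity),
    inv_mul_cancel₀ hG.ne', ENNReal.ofReal_one, one_mul] at h2
  rw [wNorm, eLpNorm_one_eq_lintegral_enorm, ENNReal.ofReal_add (by positivity) (by positivity),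
    add_mul, add_assoc]
  exact add_le_add h1 h2

lemma mem_W_of_wNorm_lt_top {v : E n → ℝ} (hv : AEMeasurable v (volume.restrict Ω))
    (h : wNorm s Ω v < ∞) : v ∈ W s Ω := by
  rw [wNorm, ENNReal.add_lt_top] at h
  exact ⟨⟨hv.aestronglyMeasurable, h.1⟩, h.2⟩

lemma midpoint_mem_W {u v : E n → ℝ} (hu : u ∈ W s Ω) (hv : v ∈ W s Ω) :
    (fun x => (u x + v x) / 2) ∈ W s Ω := by
  have hum := hu.1.1.aemeasurable
  have hvm := hv.1.1.aemeasurable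
  have hmem : MemLp (fun x => (u x + v x) / 2) 1 (volume.restrict Ω) := by
    simpa only [div_eq_inv_mul, Pi.add_apply] using (hu.1.add hv.1).const_mul 2⁻¹
  refine ⟨hmem, ?_⟩
  rw [gagliardo_eq_lintegral_prod hmem.1.aemeasurable]
  have h : gagliardo s Ω u + gagliardo s Ω v < ∞ := ENNReal.add_lt_top.2 ⟨hu.2, hv.2⟩
  refine lt_of_le_of_lt ?_ h
  rw [gagliardo_eq_lintegral_prod hum, gagliardo_eq_lintegral_prod hvm, ← lintegral_add_left']
  · refine lintegral_mono fun p => ?_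
    rw [← ENNReal.ofReal_add (by positivity) (by positivity), ← add_mul]
    refine ENNReal.ofReal_le_ofReal (mul_le_mul_of_nonneg_right ?_ (by positivity))
    have h1 := abs_add_le (u p.1 - u p.2) (v p.1 - v p.2)
    have h2 : |(u p.1 - u p.2) + (v p.1 - v p.2)| =
        2 * |(u p.1 + v p.1) / 2 - (u p.2 + v p.2) / 2| := by
      rw [← abs_of_pos (zero_lt_two (α := ℝ)), ← abs_mul, abs_of_pos (zero_lt_two (α := ℝ))]
      congr 1; ring
    have h3 := abs_nonneg ((u p.1 + v p.1) / 2 - (u p.2 + v p.2) / 2)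
    linarith
  · exact ((hum.comp_fst.sub hum.comp_snd).abs.mul
      (by fun_prop : Measurable fun p : E n × E n =>
        1 / ‖p.1 - p.2‖ ^ ((n : ℝ) + s)).aemeasurable).ennreal_ofReal

lemma midpoint_mem_admissible {A : Set (E n)} {ψ u v : E n → ℝ}
    (hu : u ∈ admissible s Ω A φ ψ) (hv : v ∈ admissible s Ω A φ ψ) :
    (fun x => (u x + v x) / 2) ∈ admissible s Ω A φ ψ := by
  refine ⟨midpoint_mem_W hu.1 hv.1, fun x hx => ?_, ?_⟩
  · simp only [hu.2.1 x hx, hv.2.1 x hx, add_self_div_two]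
  · filter_upwards [hu.2.2, hv.2.2] with x h1 h2
    linarith

/-- Solutions are unique: by strict convexity, comparing both solutions with their midpoint shows
that they have equal increments between almost all points of `Ω` and of its complement, and they
agree on the complement. -/
lemma SolvesObstacle.ae_eq (hn : 1 ≤ n) (hΩ : IsOpen Ω) (hb : Bornology.IsBounded Ω)
    {A : Set (E n)} {ψ u v : E n → ℝ} (hu : SolvesObstacle s Ω A φ ψ u)
    (hv : SolvesObstacle s Ω A φ ψ v) : v =ᵐ[volume] u := by
  have := nontrivial_E hn
  have hw := midpoint_mem_admissible hu.1 hv.1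
  obtain ⟨hui, hu0⟩ := hu.2 _ hw
  obtain ⟨hvi, hv0⟩ := hv.2 _ hw
  set w : E n → ℝ := fun x => (u x + v x) / 2 with hwdef
  have hsum : ∀ p, densityDiff s u w p + densityDiff s v w p =
      edens s p.1 p.2 (u p.1 - u p.2) + edens s p.1 p.2 (v p.1 - v p.2) -
        2 * edens s p.1 p.2 (((u p.1 - u p.2) + (v p.1 - v p.2)) / 2) := by
    intro p
    rw [densityDiff_eq, densityDiff_eq, show w p.1 - w p.2 =
      ((u p.1 - u p.2) + (v p.1 - v p.2)) / 2 by simp only [hwdef]; ring]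
    ring
  have hnn : ∀ p, 0 ≤ densityDiff s u w p + densityDiff s v w p := fun p => by
    rw [hsum]
    linarith [edens_midpoint_le (s := s) p.1 p.2 (u p.1 - u p.2) (v p.1 - v p.2)]
  have hzero : ∫ p in Q Ω, (densityDiff s u w p + densityDiff s v w p) = 0 := by
    refine le_antisymm ?_ (integral_nonneg hnn)
    rw [integral_add hui hvi]
    linarith
  rw [integral_eq_zero_iff_of_nonneg hnn (hui.add hvi)] at hzero
  have hsub : Ω ×ˢ Ωᶜ ⊆ Q Ω := fun p hp hq => hq.1 hp.1
  have h1 := ae_restrict_of_ae_restrict_of_subset hsub hzero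
  rw [Measure.volume_eq_prod, ← Measure.prod_restrict] at h1
  have h2 := Measure.ae_ae_of_ae_prod h1
  have hc : volume Ωᶜ ≠ 0 := by
    intro h
    have h3 : volume (univ : Set (E n)) ≤ volume Ω + volume Ωᶜ := by
      rw [← union_compl_self Ω]; exact measure_union_le _ _
    rw [h, add_zero, measure_univ_of_isAddLeftInvariant] at h3
    exact (hb.measure_lt_top.trans_le h3).ne rfl
  have : (ae (volume.restrict Ωᶜ)).NeBot := ae_neBot.2 fun h => hc (Measure.restrict_eq_zero.1 h)
  have h4 : ∀ᵐ x ∂(volume.restrict Ω), v x = u x := by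
    filter_upwards [h2, ae_restrict_mem hΩ.measurableSet] with x hx hxΩ
    obtain ⟨y, hy, hyΩ⟩ := (hx.and (ae_restrict_mem hΩ.measurableSet.compl)).exists
    have hxy : x ≠ y := fun h => hyΩ (h ▸ hxΩ)
    simp only [Pi.zero_apply] at hy
    rw [hsum] at hy
    have h5 := eq_of_edens_midpoint_eq hxy (sub_eq_zero.1 hy).le
    simp only [hu.1.2.1 y hyΩ, hv.1.2.1 y hyΩ] at h5
    linarith
  rw [ae_restrict_iff' hΩ.measurableSet] at h4
  filter_upwards [h4] with x hx
  by_cases h : x ∈ Ω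
  · exact hx h
  · rw [hv.1.2.1 x h, hu.1.2.1 x h]

/-- Among the measurable functions above the obstacle, the renormalized energy has a minimizer. -/
lemma exists_energy_minimizer (hn : 1 ≤ n) (hs : 0 < s) (hΩ : IsOpen Ω)
    (hφ : AEMeasurable φ (volume.restrict Ωᶜ)) (hbi : Integrable b (volume.restrict Ω)) {c : ℝ}
    (hc : 0 < c) (hb : ∀ᵐ x ∂(volume.restrict Ω), ∀ t, c * |t| ≤ extEnergy s Ω φ K x t + b x)
    {A : Set (E n)} (hA : A ⊆ Ω) {ψ : E n → ℝ} (hψ : ∀ᵐ x ∂(volume.restrict A), ψ x ≤ K) :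
    ∃ u : E n → ℝ, AEMeasurable u (volume.restrict Ω) ∧
      (∀ᵐ x ∂(volume.restrict A), ψ x ≤ u x) ∧
      ∀ v : E n → ℝ, AEMeasurable v (volume.restrict Ω) →
        (∀ᵐ x ∂(volume.restrict A), ψ x ≤ v x) → energy s Ω φ K b u ≤ energy s Ω φ K b v := by
  obtain ⟨u, hu, hmin⟩ := exists_minimizer_of_submodular (μ := volume.restrict Ω)
    (𝒜 := {v : E n → ℝ | AEMeasurable v (volume.restrict Ω) ∧
      ∀ᵐ x ∂(volume.restrict A), ψ x ≤ v x}) (Φ := energy s Ω φ K b)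
    (c := ENNReal.ofReal (2 * c)) (u₀ := fun _ => K) (fun u hu => hu.1)
    (fun u hu v hv => ⟨hu.1.inf hv.1, by
      filter_upwards [hu.2, hv.2] with x h1 h2 using le_inf h1 h2⟩)
    (fun u hu v hv => ⟨hu.1.sup hv.1, by
      filter_upwards [hu.2] with x h1 using h1.trans le_sup_left⟩)
    (fun u hu v hv => energy_inf_add_energy_sup_le hφ hbi.1.aemeasurable hu.1 hv.1)
    (fun v w hv hlim => ⟨⟨aemeasurable_of_tendsto_metrizable_ae' (fun k => (hv k).1) hlim, by
      filter_upwards [ae_all_iff.2 fun k => (hv k).2,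
        ae_restrict_of_ae_restrict_of_subset hA hlim] with x h1 h2 using ge_of_tendsto' h2 h1⟩,
      energy_le_liminf hn hs hΩ hφ hbi.1.aemeasurable (fun k => (hv k).1) hlim⟩)
    (by simpa using hc) ENNReal.ofReal_ne_top
    (fun u _ => lintegral_enorm_le_energy hc.le hb u) ⟨aemeasurable_const, hψ⟩
    (by
      rw [energy_const]
      refine ENNReal.mul_lt_top (by simp) (lt_of_le_of_lt (lintegral_mono fun x => ?_) hbi.2)
      rw [Real.enorm_eq_ofReal_abs]
      exact ENNReal.ofReal_le_ofReal (le_abs_self _))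
  exact ⟨u, hu.1, hu.2, fun v hv hv' => hmin v ⟨hv, hv'⟩⟩

lemma aemeasurable_tail {O : Set (E n)} (hφ : AEMeasurable φ (volume.restrict O))
    (μ : Measure (E n)) [SFinite μ] : AEMeasurable (tail s φ O) μ := by
  have h : AEMeasurable (fun p : E n × E n =>
      ENNReal.ofReal (|φ p.2| / ‖p.1 - p.2‖ ^ ((n : ℝ) + s))) (μ.prod (volume.restrict O)) :=
    (hφ.comp_snd.abs.div (by fun_prop : Measurable fun p : E n × E n =>
      ‖p.1 - p.2‖ ^ ((n : ℝ) + s)).aemeasurable).ennreal_ofReal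
  exact h.lintegral_prod_right'

lemma integrable_lowerBd {Υ C : ℝ} (hb : Bornology.IsBounded Ω)
    (hP : ∫⁻ x in Ω, extMass s Ω x < ∞) (hφ : AEMeasurable φ (volume.restrict Ωᶜ))
    (htail : ∫⁻ x in Ω, tail s φ (nbhd Ω (Υ * Metric.diam Ω) \ Ω) x < ∞) :
    Integrable (lowerBd s Ω φ K Υ C) (volume.restrict Ω) := by
  have : IsFiniteMeasure (volume.restrict Ω) := ⟨by simpa using hb.measure_lt_top⟩
  have hφN : AEMeasurable φ (volume.restrict (nbhd Ω (Υ * Metric.diam Ω) \ Ω)) :=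
    hφ.mono_measure (Measure.restrict_mono (fun y hy => hy.2) le_rfl)
  exact (((integrable_toReal_of_lintegral_ne_top (aemeasurable_tail hφN _) htail.ne).const_mul
    _).add ((integrable_toReal_of_lintegral_ne_top
      (measurable_extMass s Ω).aemeasurable hP.ne).const_mul _)).add (integrable_const _)

lemma lintegral_lowerBd_le {Υ C : ℝ} (hK : 0 ≤ K)
    (hφ : AEMeasurable φ (volume.restrict (nbhd Ω (Υ * Metric.diam Ω) \ Ω))) :
    ∫⁻ x in Ω, ENNReal.ofReal (lowerBd s Ω φ K Υ C x) ≤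
      ENNReal.ofReal (G n s 1 + 2) *
          (∫⁻ x in Ω, tail s φ (nbhd Ω (Υ * Metric.diam Ω) \ Ω) x) +
        ENNReal.ofReal (2 * K) * (∫⁻ x in Ω, extMass s Ω x) +
        ENNReal.ofReal (G n s 1 * C) * volume Ω := by
  have hG := G_one_pos n s
  have hm := aemeasurable_tail (s := s) hφ (volume.restrict Ω)
  rw [← lintegral_const_mul' _ _ ENNReal.ofReal_ne_top,
    ← lintegral_const_mul' _ _ ENNReal.ofReal_ne_top, ← setLIntegral_const,
    ← lintegral_add_left' (hm.const_mul _),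
    ← lintegral_add_right _ measurable_const]
  refine lintegral_mono fun x => ?_
  refine ENNReal.ofReal_add_le.trans (add_le_add (ENNReal.ofReal_add_le.trans
    (add_le_add ?_ ?_)) le_rfl)
  · rw [ENNReal.ofReal_mul (by positivity)]
    exact mul_le_mul' le_rfl ENNReal.ofReal_toReal_le
  · rw [ENNReal.ofReal_mul (by positivity)]
    exact mul_le_mul' le_rfl ENNReal.ofReal_toReal_le

end

end NonlocalObstacle

end

open NonlocalObstacle
theorem theorem2p3 (n : ℕ) (hn : 1 ≤ n) (s : ℝ) (hs0 : 0 < s) (hs1 : s < 1) :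
    ∃ Υ : ℝ, 1 < Υ ∧
      ∀ Ω : Set (E n), IsOpen Ω → Bornology.IsBounded Ω → HasLipschitzBoundary Ω →
        ∃ C : ℝ, 0 < C ∧
          ∀ A : Set (E n), IsOpen A → A ⊆ Ω →
          ∀ ψ : E n → ℝ, MemLp ψ ∞ (volume.restrict A) →
          ∀ φ : E n → ℝ, AEMeasurable φ (volume.restrict Ωᶜ) →
            (∫⁻ x in Ω, tail s φ (nbhd Ω (Υ * Metric.diam Ω) \ Ω) x) < ∞ →
            ∃ u : E n → ℝ, SolvesObstacle s Ω A φ ψ u ∧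
              (∀ v : E n → ℝ, SolvesObstacle s Ω A φ ψ v → v =ᵐ[volume] u) ∧
              wNorm s Ω u ≤ ENNReal.ofReal C *
                ((∫⁻ x in Ω, tail s φ (nbhd Ω (Υ * Metric.diam Ω) \ Ω) x) +
                  eLpNorm ψ ∞ (volume.restrict A) + 1) := by
  have hG := G_one_pos n s
  obtain ⟨Υ, hΥ1, hΥ⟩ := exists_tail_factor n hs0
  refine ⟨Υ, hΥ1, fun Ω hΩ hbd hL => ?_⟩
  -- for empty `Ω` the natural constant vanishes, because `0 ^ (-s) = 0`
  obtain ⟨c, hc, hcle⟩ : ∃ c : ℝ, 0 < c ∧ (Ω.Nonempty →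
      c ≤ G n s 1 * 2 ^ (-s) / 2 * (kernelMass n s * Metric.diam Ω ^ (-s))) := by
    rcases Ω.eq_empty_or_nonempty with h | h
    · exact ⟨1, one_pos, fun h' => absurd h h'.ne_empty⟩
    · have := diam_pos hn hΩ hbd h
      have := kernelMass_pos hn hs0
      exact ⟨_, by positivity, fun _ => le_rfl⟩
  obtain ⟨C₁, hC₁0, hC₁⟩ := exists_lintegral_kernel_ball_le hn hs1
    (Υ * Metric.diam Ω + Metric.diam Ω)
  obtain ⟨C₂, hC₂0, hC₂⟩ := exists_lintegral_kernel_ball_le hn hs1 (Metric.diam Ω + 1)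
  have hP := lintegral_extMass_lt_top hn hs0 hs1 hΩ hbd hL
  set P := ∫⁻ x in Ω, extMass s Ω x
  have hV : volume Ω < ∞ := hbd.measure_lt_top
  have hself : ∫⁻ x in Ω, ∫⁻ y in Ω, ENNReal.ofReal (1 / ‖x - y‖ ^ ((n : ℝ) - 1 + s)) ≤
      ENNReal.ofReal C₂ * volume Ω := by
    calc _ ≤ ∫⁻ x in Ω, ENNReal.ofReal C₂ := by
          refine setLIntegral_mono' hΩ.measurableSet fun x hx => ?_
          refine (lintegral_mono_set fun y hy => ?_).trans (hC₂ x)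
          rw [Metric.mem_ball]
          linarith [Metric.dist_le_diam_of_mem hbd hy hx]
      _ = _ := setLIntegral_const _ _
  -- the competitor for the estimate is the constant `K = ‖ψ‖_∞` in `Ω`; its energy is twice the
  -- integral of `lowerBd`, which accounts for the three summands of `S`
  let a : ℝ := (2 * c)⁻¹ + (G n s 1)⁻¹
  have ha : 0 < a := by positivity
  let S : ℝ := 2 * (G n s 1 + 2) + 4 * P.toReal + 2 * G n s 1 * C₁ * (volume Ω).toReal
  let β : ℝ := C₂ * (volume Ω).toReal
  have hS1 : 2 * (G n s 1 + 2) ≤ S := by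
    have : 0 ≤ 4 * P.toReal + 2 * G n s 1 * C₁ * (volume Ω).toReal := by positivity
    simp only [S]; linarith
  have hS : 0 < S := lt_of_lt_of_le (by positivity) hS1
  have hβ : 0 ≤ β := by positivity
  refine ⟨a * S + β, by positivity, fun A hA hAΩ ψ hψ φ hφ htail => ?_⟩
  set T := ∫⁻ x in Ω, tail s φ (nbhd Ω (Υ * Metric.diam Ω) \ Ω) x
  set K : ℝ := (eLpNorm ψ ∞ (volume.restrict A)).toReal
  have hK0 : 0 ≤ K := ENNReal.toReal_nonneg
  have hKofReal : ENNReal.ofReal K = eLpNorm ψ ∞ (volume.restrict A) :=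
    ENNReal.ofReal_toReal hψ.2.ne
  have hψK : ∀ᵐ x ∂(volume.restrict A), ψ x ≤ K := by
    filter_upwards [enorm_ae_le_eLpNormEssSup ψ (volume.restrict A)] with x hx
    rw [← eLpNorm_exponent_top, ← hKofReal, Real.enorm_eq_ofReal_abs,
      ENNReal.ofReal_le_ofReal_iff hK0] at hx
    exact (le_abs_self _).trans hx
  have hφN : AEMeasurable φ (volume.restrict (nbhd Ω (Υ * Metric.diam Ω) \ Ω)) :=
    hφ.mono_measure (Measure.restrict_mono (fun y hy => hy.2) le_rfl)
  have hbi : Integrable (lowerBd s Ω φ K Υ C₁) (volume.restrict Ω) :=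
    integrable_lowerBd hbd hP hφ htail
  have hlow : ∀ᵐ x ∂(volume.restrict Ω), ∀ t,
      c * |t| ≤ extEnergy s Ω φ K x t + lowerBd s Ω φ K Υ C₁ x := by
    filter_upwards [ae_lt_top' (aemeasurable_tail hφN _) htail.ne,
      ae_restrict_mem hΩ.measurableSet] with x hx hxΩ t
    exact (mul_le_mul_of_nonneg_right (hcle ⟨x, hxΩ⟩) (abs_nonneg t)).trans
      (extEnergy_add_lowerBd_ge hn hs0 hΩ hbd hΥ1 hΥ hφ hK0 hC₁0 hC₁ hxΩ hx t)
  obtain ⟨u₀, hu₀m, hu₀ψ, hmin⟩ := exists_energy_minimizer hn hs0 hΩ hφ hbi hc hlow hAΩ hψK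
  classical
  let u : E n → ℝ := Ω.piecewise u₀ φ
  have huΩ : u =ᵐ[volume.restrict Ω] u₀ := by
    filter_upwards [ae_restrict_mem hΩ.measurableSet] with x hx
    exact piecewise_eq_of_mem _ _ _ hx
  have huc : ∀ x ∈ Ωᶜ, u x = φ x := fun x hx => piecewise_eq_of_notMem _ _ _ hx
  have hum : AEMeasurable u (volume.restrict Ω) := hu₀m.congr huΩ.symm
  have huψ : ∀ᵐ x ∂(volume.restrict A), ψ x ≤ u x := by
    filter_upwards [hu₀ψ, ae_restrict_of_ae_restrict_of_subset hAΩ huΩ] with x h1 h2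
    exact h1.trans h2.ge
  have humin : ∀ v : E n → ℝ, AEMeasurable v (volume.restrict Ω) →
      (∀ᵐ x ∂(volume.restrict A), ψ x ≤ v x) →
      energy s Ω φ K (lowerBd s Ω φ K Υ C₁) u ≤ energy s Ω φ K (lowerBd s Ω φ K Υ C₁) v := by
    rw [energy_congr huΩ]; exact hmin
  have hnorm : wNorm s Ω u ≤ ENNReal.ofReal (a * S + β) *
      (T + eLpNorm ψ ∞ (volume.restrict A) + 1) := by
    have h1 := humin (fun _ => K) aemeasurable_const hψK
    rw [energy_const] at h1
    have h2 : energy s Ω φ K (lowerBd s Ω φ K Υ C₁) u ≤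
        ENNReal.ofReal S * (T + eLpNorm ψ ∞ (volume.restrict A) + 1) := by
      refine h1.trans ((mul_le_mul' le_rfl (lintegral_lowerBd_le hK0 hφN)).trans ?_)
      change 2 * (ENNReal.ofReal (G n s 1 + 2) * T + ENNReal.ofReal (2 * K) * P +
        ENNReal.ofReal (G n s 1 * C₁) * volume Ω) ≤ _
      have htwo : ∀ z : ℝ≥0∞, 2 * z = ENNReal.ofReal 2 * z := fun z => by
        rw [ENNReal.ofReal_ofNat]
      rw [htwo, ← ENNReal.ofReal_toReal hP.ne, ← ENNReal.ofReal_toReal hV.ne, ← hKofReal,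
        ← ENNReal.ofReal_mul (by positivity), ← ENNReal.ofReal_mul (by positivity), mul_add,
        mul_add, mul_add, mul_add, mul_one, ← mul_assoc,
        ← ENNReal.ofReal_mul zero_le_two, ← ENNReal.ofReal_mul zero_le_two,
        ← ENNReal.ofReal_mul zero_le_two, ← ENNReal.ofReal_mul hS.le]
      refine add_le_add (add_le_add (mul_le_mul' (ENNReal.ofReal_le_ofReal hS1) le_rfl)
        (ENNReal.ofReal_le_ofReal ?_)) (ENNReal.ofReal_le_ofReal ?_)
      · have h3 : 4 * P.toReal ≤ S := by
          have : 0 ≤ 2 * (G n s 1 + 2) + 2 * G n s 1 * C₁ * (volume Ω).toReal := by positivity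
          simp only [S]; linarith
        nlinarith
      · have : 0 ≤ 2 * (G n s 1 + 2) + 4 * P.toReal := by positivity
        simp only [S]; linarith
    calc wNorm s Ω u ≤ ENNReal.ofReal a * energy s Ω φ K (lowerBd s Ω φ K Υ C₁) u +
          ENNReal.ofReal C₂ * volume Ω :=
          (wNorm_le_energy hn hs0 hc hlow hum).trans (add_le_add le_rfl hself)
      _ ≤ ENNReal.ofReal a * (ENNReal.ofReal S * (T + eLpNorm ψ ∞ (volume.restrict A) + 1)) +
          ENNReal.ofReal β * (T + eLpNorm ψ ∞ (volume.restrict A) + 1) := by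
          refine add_le_add (mul_le_mul' le_rfl h2) ?_
          rw [ENNReal.ofReal_mul hC₂0, ENNReal.ofReal_toReal hV.ne]
          exact le_mul_of_one_le_right' le_add_self
      _ = _ := by
          rw [ENNReal.ofReal_add (by positivity) hβ, ENNReal.ofReal_mul ha.le, add_mul, mul_assoc]
  have huW : u ∈ W s Ω := by
    refine mem_W_of_wNorm_lt_top hum (hnorm.trans_lt (ENNReal.mul_lt_top ENNReal.ofReal_lt_top ?_))
    exact ENNReal.add_lt_top.2 ⟨ENNReal.add_lt_top.2 ⟨htail, hψ.2⟩, ENNReal.one_lt_top⟩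
  have husol : SolvesObstacle s Ω A φ ψ u := by
    refine ⟨⟨huW, huc, huψ⟩, fun v hv => ?_⟩
    obtain ⟨-, hvfin, hint, heq⟩ := integral_densityDiff_eq (K := K)
      (b := lowerBd s Ω φ K Υ C₁) hn hs0 hΩ hφ hP hbi
      (hlow.mono fun x hx t => (by positivity : 0 ≤ c * |t|).trans (hx t)) huW hv.1
      (lintegral_mul_extMass_lt_top hn hs0 hs1 hΩ hbd hL huW)
      (lintegral_mul_extMass_lt_top hn hs0 hs1 hΩ hbd hL hv.1) huc hv.2.1
    refine ⟨hint, ?_⟩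
    rw [heq, sub_nonpos]
    exact ENNReal.toReal_mono hvfin.ne (humin v hv.1.1.1.aemeasurable hv.2.2)
  exact ⟨u, husol, fun v hv => husol.ae_eq hn hΩ hbd hv, hnorm⟩
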